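/- Let $k$ be a local field of characteristic zero, $|\cdot|$ its normalized absolute value (the module of Haar measure; on $\mathbb C$ it is $|z|=z\bar z$), $\psi$ a nontrivial continuous unitary additive character of $k$, and $dr$ the Haar measure on $k$ that is self-dual with respect to $\psi(rt)$. Let $(V,q)$ be a non-degenerate finite-dimensional quadratic space over $k$ with $\dim V\ge 2$, put $q(X,Y)=q(X+Y)-q(X)-q(Y)$, and let $dX$ be the Haar measure on $V$ that is self-dual with respect to $\psi(q(X,Y))$. For $W\in L^1(k)$ and $f\in L^1(V)$ define $$\mathcal F_2W(t)=\int_k W(r)\,\psi(r^2t)\,dr,\qquad \mathcal F_qf(t)=\int_V f(X)\,\psi(t\,q(X))\,dX .$$ Let $\phi$ be a Bruhat–Schwartz function on $V$ (a Schwartz function if $k$ is archimedean, a locally constant function of compact support if $k$ is nonarchimedean), and let $W\in L^1(k)$ be a complex-valued even function such that $W(x)^2|x|^{-1}\in L^1(k)$. For $\delta\in k^\times$ set $V_{[\delta]}=\{X\in V: q(X)\in\delta (k^{\times})^2\}$. Then $$\int_k \mathcal F_2W(\delta t)\,\mathcal F_q\phi(-t)\,dt \;=\; 2|2\delta|^{-1}\int_{V_{[\delta]}}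 W\!\left(\sqrt{\delta^{-1}q(X)}\right)\phi(X)\,\left|\delta^{-1}q(X)\right|^{-1/2}\,dX ,$$ where both integrals converge absolutely; the choice of the square root does not matter because $W$ is even. -/

import Mathlib

open MeasureTheory

noncomputable section

namespace QuadraticFourier

/-- The normalized absolute value `|a|` of a locally compact field: the factor by which
multiplication by `a` scales Haar measure (so `|z| = z * conj z` on `ℂ`), with `|0| = 0`. -/
def modulus {k : Type*} [NontriviallyNormedField k] [LocallyCompactSpace k] (a : k) : ℝ :=
  open Classical in
  if h : a = 0 then 0 else (distribHaarChar k (Units.mk0 a h) : ℝ)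

/-- The Fourier transform `ℱ f (x) = ∫ f(y) ψ(B(y, x)) dy` attached to an additive character `ψ`
of `k` and a bilinear form `B` on `E`. -/
def bilinFourier {k E : Type*} [Field k] [AddCommGroup E] [Module k E] [MeasurableSpace E]
    (ψ : AddChar k Circle) (B : LinearMap.BilinForm k E) (μ : Measure E) (f : E → ℂ) (x : E) : ℂ :=
  ∫ y, f y * (ψ (B y x) : ℂ) ∂μ

/-- `μ` is the self-dual Haar measure of `E` for the pairing `ψ(B(x, y))`: it is a Haar measure
and the inversion formula `ℱ (ℱ f) (x) = f (-x)` holds for continuous integrable `f` whose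
transform is integrable. -/
def IsSelfDual {k E : Type*} [Field k] [AddCommGroup E] [Module k E] [TopologicalSpace E]
    [MeasurableSpace E] (ψ : AddChar k Circle) (B : LinearMap.BilinForm k E)
    (μ : Measure E) : Prop :=
  μ.IsAddHaarMeasure ∧
    ∀ f : E → ℂ, Continuous f → Integrable f μ → Integrable (bilinFourier ψ B μ f) μ →
      ∀ x, bilinFourier ψ B μ (bilinFourier ψ B μ f) x = f (-x)

/-- `ℱ₂ W (t) = ∫ W(r) ψ(r² t) dr`. -/
def fourierTwo {k : Type*} [Field k] [MeasurableSpace k]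
    (ψ : AddChar k Circle) (μ : Measure k) (W : k → ℂ) (t : k) : ℂ :=
  ∫ r, W r * (ψ (r ^ 2 * t) : ℂ) ∂μ

/-- `ℱ_q f (t) = ∫ f(X) ψ(t q(X)) dX`. -/
def fourierQuad {k V : Type*} [Field k] [AddCommGroup V] [Module k V] [MeasurableSpace V]
    (ψ : AddChar k Circle) (q : QuadraticForm k V) (ν : Measure V) (f : V → ℂ) (t : k) : ℂ :=
  ∫ X, f X * (ψ (t * q X) : ℂ) ∂ν

/-- Bruhat–Schwartz functions on a finite-dimensional vector space `V` over the local field `k`.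
If `k` is nonarchimedean: locally constant functions with compact support.
If `k` is archimedean: Schwartz functions of the real coordinates of `V`; an additive homeomorphism
`V ≃ ℝᴺ` is automatically real linear, so the choice of `e` does not matter. -/
def IsBruhatSchwartz (k : Type*) {V : Type*} [NontriviallyNormedField k] [AddCommGroup V]
    [TopologicalSpace V] (φ : V → ℂ) : Prop :=
  (IsUltrametricDist k ∧ IsLocallyConstant φ ∧ HasCompactSupport φ) ∨
  (¬ IsUltrametricDist k ∧ ∃ (N : ℕ) (e : V ≃ₜ+ EuclideanSpace ℝ (Fin N))
    (f : SchwartzMap (EuclideanSpace ℝ (Fin N)) ℂ), ∀ X, φ X = f (e X))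

/-- The set `V_[δ]` of vectors `X` with `q(X) ∈ δ (kˣ)²`. -/
def squareClassSet {k V : Type*} [Field k] [AddCommGroup V] [Module k V]
    (q : QuadraticForm k V) (δ : k) : Set V :=
  {X | ∃ a : k, a ≠ 0 ∧ q X = δ * a ^ 2}

/-- A chosen square root of `a`, if there is one. -/
def root {k : Type*} [Field k] (a : k) : k :=
  open Classical in
  if h : ∃ r : k, r ^ 2 = a then h.choose else 0

end QuadraticFourier

end

open MeasureTheory

namespace QuadraticFourier

open Filter Topology ENNReal Pointwise ComplexConjugate

/-! ### The modulus: multiplicativity, scaling of Haar measure, continuity. -/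

section Modulus

variable {k : Type*} [NontriviallyNormedField k] [LocallyCompactSpace k]

/-! The substitution u = r² turns F₂W into the ordinary Fourier transform of u ↦ 2|2|⁻¹|u|^{-1/2}
W(√u) on the nonzero squares (`map_sq_haar`, `fourierField_pushSquare`). Let G be the dilate of this
function by δ, normalized so that its transform Ĝ satisfies Ĝ(t) = F₂W(δt). The theorem then reads ∫
Ĝ(t) F_qφ(-t) dt = ∫ φ(X) G(q(X)) dX, which is formally Fubini and Fourier inversion. The condition
on W²/|x| says exactly that G lies in L²; since G may be unbounded, inversion cannot be applied to
it directly.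

The remedy is to show that both sides are continuous in G for the L² norm and to argue by density
from continuous functions of compact support (`integral_fourier_mul_fourierQuad`). On the left,
writing |F_qφ(t)|² as a double integral removes the quadratic phase and gives |F_qφ(t)|² ≤
|t|^{-n}‖φ̂‖₁² with n = dim V (`enorm_fourierQuad_sq_le`). As n ≥ 2, F_qφ is in L², and
Cauchy–Schwarz applies together with an L² bound for the Fourier transform
(`lintegral_fourierField_sq_le`).

On the right one needs ∫ |φ(X)| |H(q(X))| dX ≤ C‖H‖₂. If φ ≥ 0, the identity for nice H, proved with
a summation kernel, already yields this bound (`isQuadraticallyBounded_of_nonneg`). In the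
nonarchimedean case |φ| is again locally constant of compact support, which suffices. In the
archimedean case |φ| need not be smooth, so it is dominated by a convergent sum of dilates of a
nonnegative bump (`isQuadraticallyBounded_of_schwartz`). -/

lemma modulus_zero : modulus (0 : k) = 0 := by simp [modulus]

lemma modulus_of_ne_zero {a : k} (ha : a ≠ 0) :
    modulus a = (distribHaarChar k (Units.mk0 a ha) : ℝ) := by simp [modulus, ha]

lemma modulus_pos {a : k} (ha : a ≠ 0) : 0 < modulus a := by
  rw [modulus_of_ne_zero ha]
  exact_mod_cast distribHaarChar_pos

lemma modulus_nonneg (a : k) : 0 ≤ modulus a := by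
  rcases eq_or_ne a 0 with rfl | ha
  · exact modulus_zero.ge
  · exact (modulus_pos ha).le

lemma modulus_mul (a b : k) : modulus (a * b) = modulus a * modulus b := by
  rcases eq_or_ne a 0 with rfl | ha
  · simp [modulus_zero]
  rcases eq_or_ne b 0 with rfl | hb
  · simp [modulus_zero]
  rw [modulus_of_ne_zero ha, modulus_of_ne_zero hb, modulus_of_ne_zero (mul_ne_zero ha hb),
    ← NNReal.coe_mul, ← map_mul, Units.mk0_mul]

lemma modulus_one : modulus (1 : k) = 1 := by
  rw [modulus_of_ne_zero one_ne_zero]; simp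

lemma modulus_inv (a : k) : modulus a⁻¹ = (modulus a)⁻¹ := by
  rcases eq_or_ne a 0 with rfl | ha
  · simp [modulus_zero]
  exact eq_inv_of_mul_eq_one_left (by rw [← modulus_mul, inv_mul_cancel₀ ha, modulus_one])

lemma modulus_pow (a : k) (n : ℕ) : modulus (a ^ n) = modulus a ^ n := by
  induction n with
  | zero => simp [modulus_one]
  | succ n ih => rw [pow_succ, modulus_mul, ih, pow_succ]

variable [MeasurableSpace k] [BorelSpace k] (μ : Measure k) [μ.IsAddHaarMeasure]

instance (priority := 50) properSpace_of_locallyCompact : ProperSpace k :=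
  ProperSpace.of_locallyCompactSpace k

lemma measure_smul_set {a : k} (ha : a ≠ 0) (s : Set k) :
    μ ((Units.mk0 a ha) • s) = ENNReal.ofReal (modulus a) * μ s := by
  rw [← distribHaarChar_mul μ, modulus_of_ne_zero ha, ENNReal.ofReal_coe_nnreal]

lemma map_mul_left_haar {a : k} (ha : a ≠ 0) :
    μ.map (fun x => a * x) = ENNReal.ofReal (modulus a)⁻¹ • μ := by
  ext s hs
  rw [Measure.map_apply (by fun_prop) hs, Measure.smul_apply, smul_eq_mul, ← modulus_inv,
    ← measure_smul_set μ (inv_ne_zero ha)]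
  congr 1
  ext x
  rw [Set.mem_smul_set_iff_inv_smul_mem]
  simp [Units.smul_def]

lemma lintegral_comp_mul_left {a : k} (ha : a ≠ 0) (f : k → ℝ≥0∞) :
    ∫⁻ x, f (a * x) ∂μ = ENNReal.ofReal (modulus a)⁻¹ * ∫⁻ x, f x ∂μ := by
  rw [← smul_eq_mul, ← lintegral_smul_measure, ← map_mul_left_haar μ ha]
  exact ((Homeomorph.mulLeft₀ a ha).measurableEmbedding.lintegral_map _).symm

lemma integral_comp_mul_left {a : k} (ha : a ≠ 0) (f : k → ℂ) :
    ∫ x, f (a * x) ∂μ = ((modulus a)⁻¹ : ℝ) * ∫ x, f x ∂μ := by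
  have h := (Homeomorph.mulLeft₀ a ha).measurableEmbedding.integral_map (μ := μ) f
  rw [Homeomorph.coe_mulLeft₀, map_mul_left_haar μ ha, integral_smul_measure,
    ENNReal.toReal_ofReal (inv_nonneg.2 (modulus_nonneg a))] at h
  rw [← h]; simp

lemma integrable_comp_mul_left {E : Type*} [NormedAddCommGroup E] {a : k} (ha : a ≠ 0) {f : k → E}
    (hf : Integrable f μ) : Integrable (fun x => f (a * x)) μ := by
  refine ((Homeomorph.mulLeft₀ a ha).measurableEmbedding.integrable_map_iff).1 ?_
  rw [Homeomorph.coe_mulLeft₀, map_mul_left_haar μ ha]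
  exact hf.smul_measure ENNReal.ofReal_ne_top

lemma exists_isAddHaarMeasure (k : Type*) [NontriviallyNormedField k] [LocallyCompactSpace k]
    [MeasurableSpace k] [BorelSpace k] : ∃ μ : Measure k, μ.IsAddHaarMeasure :=
  ⟨Measure.addHaar, inferInstance⟩

/-- Multiplication by a carries the closed unit ball onto the closed ball of radius ‖a‖. This ties
the modulus to the norm, and hence gives its monotonicity and continuity. -/
lemma ofReal_modulus_eq (a : k) (ha : a ≠ 0) :
    ENNReal.ofReal (modulus a) =
      μ (Metric.closedBall 0 ‖a‖) / μ (Metric.closedBall (0 : k) 1) := by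
  have h0 : μ (Metric.closedBall (0 : k) 1) ≠ 0 :=
    (Metric.measure_closedBall_pos μ _ one_pos).ne'
  have h1 : μ (Metric.closedBall (0 : k) 1) ≠ ∞ := (isCompact_closedBall _ _).measure_ne_top
  rw [ENNReal.eq_div_iff h0 h1, mul_comm, ← measure_smul_set μ ha]
  congr 1
  ext x
  rw [Set.mem_smul_set_iff_inv_smul_mem]
  have := norm_pos_iff.2 ha
  simp [Units.smul_def, inv_mul_le_one₀ this]

lemma modulus_le_of_norm_le {a b : k} (h : ‖a‖ ≤ ‖b‖) : modulus a ≤ modulus b := by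
  obtain ⟨μ, _⟩ := exists_isAddHaarMeasure k
  rcases eq_or_ne a 0 with rfl | ha
  · rw [modulus_zero]; exact modulus_nonneg b
  have hb : b ≠ 0 := norm_pos_iff.1 ((norm_pos_iff.2 ha).trans_le h)
  rw [← ENNReal.ofReal_le_ofReal_iff (modulus_nonneg b), ofReal_modulus_eq μ a ha,
    ofReal_modulus_eq μ b hb]
  gcongr

lemma one_le_modulus {a : k} (h : 1 ≤ ‖a‖) : 1 ≤ modulus a := by
  obtain ⟨μ, _⟩ := exists_isAddHaarMeasure k
  rw [← modulus_one (k := k)]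
  exact modulus_le_of_norm_le (by simpa using h)

/-- The closed balls of radius r > 1 shrink to the closed unit ball as r decreases to 1, so
continuity of μ from above gives upper semicontinuity of the modulus. -/
lemma continuousAt_modulus_one : ContinuousAt (modulus : k → ℝ) 1 := by
  obtain ⟨μ, _⟩ := exists_isAddHaarMeasure k
  have h0 : μ (Metric.closedBall (0 : k) 1) ≠ 0 :=
    (Metric.measure_closedBall_pos μ _ one_pos).ne'
  have h1 : μ (Metric.closedBall (0 : k) 1) ≠ ∞ := (isCompact_closedBall _ _).measure_ne_top
  have key : ∀ c : ℝ, 1 < c → ∀ᶠ a : k in 𝓝 1, modulus a < c := by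
    intro c hc
    have ht : Tendsto (fun r => μ (Metric.closedBall (0 : k) r)) (𝓝[>] 1)
        (𝓝 (μ (⋂ r > (1 : ℝ), Metric.closedBall (0 : k) r))) :=
      tendsto_measure_biInter_gt (fun r _ => Metric.isClosed_closedBall.nullMeasurableSet)
        (fun i j _ hij => Metric.closedBall_subset_closedBall hij)
        ⟨2, by norm_num, (isCompact_closedBall _ _).measure_ne_top⟩
    have hI : (⋂ r > (1 : ℝ), Metric.closedBall (0 : k) r) = Metric.closedBall 0 1 := by
      ext x
      simp only [Set.mem_iInter, Metric.mem_closedBall, dist_zero_right]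
      exact ⟨fun h => le_of_forall_gt_imp_ge_of_dense h, fun h r hr => h.trans hr.le⟩
    rw [hI] at ht
    have hlt : μ (Metric.closedBall (0 : k) 1) < ENNReal.ofReal c * μ (Metric.closedBall 0 1) := by
      conv_lhs => rw [← one_mul (μ _)]
      rw [ENNReal.mul_lt_mul_iff_left h0 h1]
      simpa using hc
    obtain ⟨r, hr, hr1⟩ := ((ht.eventually_lt_const hlt).and self_mem_nhdsWithin).exists
    have hev : ∀ᶠ a : k in 𝓝 1, ‖a‖ < r :=
      (continuous_norm.tendsto (1 : k)).eventually_lt_const (by simpa using hr1)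
    filter_upwards [hev] with a har
    rcases eq_or_ne a 0 with rfl | ha
    · rw [modulus_zero]; linarith
    rw [← ENNReal.ofReal_lt_ofReal_iff (by linarith), ofReal_modulus_eq μ a ha]
    refine ENNReal.div_lt_of_lt_mul (lt_of_le_of_lt ?_ hr)
    exact measure_mono (Metric.closedBall_subset_closedBall har.le)
  rw [ContinuousAt, modulus_one]
  refine tendsto_order.2 ⟨fun c hc => ?_, fun c hc => key c hc⟩
  rcases le_or_gt c 0 with hc0 | hc0
  · filter_upwards [eventually_ne_nhds (one_ne_zero (α := k))] with a ha
    exact hc0.trans_lt (modulus_pos ha)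
  -- The lower bound is the upper bound applied to a⁻¹.
  have hinv : Tendsto (fun a : k => a⁻¹) (𝓝 1) (𝓝 1) := by
    simpa using (continuousAt_inv₀ (one_ne_zero (α := k))).tendsto
  filter_upwards [hinv.eventually (key c⁻¹ ((one_lt_inv₀ hc0).2 hc)),
    eventually_ne_nhds (one_ne_zero (α := k))] with a ha ha0
  rw [modulus_inv] at ha
  exact (inv_lt_inv₀ (modulus_pos ha0) hc0).1 ha

lemma continuousAt_modulus {a : k} (ha : a ≠ 0) : ContinuousAt (modulus : k → ℝ) a := by
  obtain ⟨μ, _⟩ := exists_isAddHaarMeasure k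
  have h : (modulus : k → ℝ) = fun x => modulus a * modulus (a⁻¹ * x) := by
    ext x; rw [← modulus_mul, mul_inv_cancel_left₀ ha]
  rw [h]
  refine ContinuousAt.mul continuousAt_const (ContinuousAt.comp (g := modulus) ?_
    (continuous_const_mul a⁻¹).continuousAt)
  rw [inv_mul_cancel₀ ha]
  exact continuousAt_modulus_one

lemma measurable_modulus : Measurable (modulus : k → ℝ) := by
  obtain ⟨μ, _⟩ := exists_isAddHaarMeasure k
  refine measurable_of_measurable_on_compl_singleton 0 ?_
  refine Continuous.measurable (continuous_iff_continuousAt.2 fun x => ?_)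
  exact (continuousAt_modulus x.2).comp continuousAt_subtype_val

end Modulus

/-! ### The open set of nonzero squares. -/

section Squares

variable {k : Type*} [NontriviallyNormedField k]

/-- The set of nonzero squares. -/
def nonzeroSquares (k : Type*) [Field k] : Set k := {u | ∃ r : k, r ≠ 0 ∧ r ^ 2 = u}

lemma mul_mem_nonzeroSquares {a u : k} (ha : a ≠ 0) :
    a ^ 2 * u ∈ nonzeroSquares k ↔ u ∈ nonzeroSquares k := by
  constructor
  · rintro ⟨r, hr, h⟩
    refine ⟨r / a, div_ne_zero hr ha, ?_⟩
    rw [div_pow, h, mul_div_cancel_left₀ _ (pow_ne_zero 2 ha)]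
  · rintro ⟨r, hr, rfl⟩
    exact ⟨a * r, mul_ne_zero ha hr, mul_pow _ _ _⟩

lemma inv_mem_nonzeroSquares {u : k} : u⁻¹ ∈ nonzeroSquares k ↔ u ∈ nonzeroSquares k := by
  have : ∀ v : k, v ∈ nonzeroSquares k → v⁻¹ ∈ nonzeroSquares k := by
    rintro _ ⟨r, hr, rfl⟩
    exact ⟨r⁻¹, inv_ne_zero hr, inv_pow _ _⟩
  exact ⟨fun h => inv_inv u ▸ this _ h, this u⟩

variable [LocallyCompactSpace k]

/-- Inverse function theorem: the derivative 2a does not vanish in characteristic zero. -/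
lemma map_sq_nhds [CharZero k] {a : k} (ha : a ≠ 0) :
    map (fun x : k => x ^ 2) (𝓝 a) = 𝓝 (a ^ 2) := by
  have : CompleteSpace k := inferInstance
  have h : HasStrictDerivAt (fun x : k => x ^ 2) (2 * a) a := by
    simpa using hasStrictDerivAt_pow 2 a
  exact h.map_nhds_eq (mul_ne_zero two_ne_zero ha)

lemma image_sq_isOpen [CharZero k] {s : Set k} (hs : IsOpen s) (h0 : 0 ∉ s) :
    IsOpen ((fun x : k => x ^ 2) '' s) := by
  rw [isOpen_iff_mem_nhds]
  rintro _ ⟨a, ha, rfl⟩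
  have : a ≠ 0 := fun h => h0 (h ▸ ha)
  rw [← map_sq_nhds this]
  exact image_mem_map (hs.mem_nhds ha)

lemma isOpen_nonzeroSquares [CharZero k] : IsOpen (nonzeroSquares k) := by
  have : nonzeroSquares k = (fun x : k => x ^ 2) '' {0}ᶜ := by
    ext u; simp [nonzeroSquares]
  rw [this]
  exact image_sq_isOpen isOpen_compl_singleton (by simp)

end Squares

/-! ### The multiplicative measure dx/|x|, its invariance, and squaring. -/

section Multiplicative

variable {k : Type*} [NontriviallyNormedField k] [LocallyCompactSpace k]
  [MeasurableSpace k] [BorelSpace k] (μ : Measure k)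

/-- The measure `dx / |x|` on `k`. -/
noncomputable def mulHaar (μ : Measure k) : Measure k :=
  μ.withDensity fun x => ENNReal.ofReal (modulus x)⁻¹

lemma measurable_ofReal_inv_modulus : Measurable fun x : k => ENNReal.ofReal (modulus x)⁻¹ :=
  measurable_modulus.inv.ennreal_ofReal

lemma lintegral_mulHaar {f : k → ℝ≥0∞} (hf : Measurable f) :
    ∫⁻ x, f x ∂mulHaar μ = ∫⁻ x, ENNReal.ofReal (modulus x)⁻¹ * f x ∂μ :=
  lintegral_withDensity_eq_lintegral_mul _ measurable_ofReal_inv_modulus hf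

/-- With the convention 0⁻¹ = 0 the density vanishes at 0, so that point carries no mass. -/
lemma ae_mulHaar_ne_zero : ∀ᵐ x ∂mulHaar μ, x ≠ 0 := by
  rw [ae_iff]
  simp only [ne_eq, not_not, Set.ofPred_eq_eq_singleton]
  rw [mulHaar, withDensity_apply _ (measurableSet_singleton 0)]
  simp [modulus_zero]

variable [μ.IsAddHaarMeasure]

instance sFinite_mulHaar : SFinite (mulHaar μ) := by unfold mulHaar; infer_instance

lemma lintegral_mulHaar_comp_mul_left {a : k} (ha : a ≠ 0) {f : k → ℝ≥0∞} (hf : Measurable f) :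
    ∫⁻ x, f (a * x) ∂mulHaar μ = ∫⁻ x, f x ∂mulHaar μ := by
  rw [lintegral_mulHaar μ (by fun_prop), lintegral_mulHaar μ hf]
  have h : ∀ x, ENNReal.ofReal (modulus x)⁻¹ * f (a * x) =
      ENNReal.ofReal (modulus a) * (ENNReal.ofReal (modulus (a * x))⁻¹ * f (a * x)) := by
    intro x
    rw [← mul_assoc, ← ENNReal.ofReal_mul (modulus_nonneg a), modulus_mul, mul_inv,
      mul_inv_cancel_left₀ (modulus_pos ha).ne']
  simp_rw [h]
  rw [lintegral_const_mul' _ _ ENNReal.ofReal_ne_top,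
    lintegral_comp_mul_left μ ha (fun x => ENNReal.ofReal (modulus x)⁻¹ * f x), ← mul_assoc,
    ← ENNReal.ofReal_mul (modulus_nonneg a), mul_inv_cancel₀ (modulus_pos ha).ne',
    ENNReal.ofReal_one, one_mul]

lemma exists_mulHaar_pos_lt_top :
    ∃ s : Set k, MeasurableSet s ∧ mulHaar μ s ≠ 0 ∧ mulHaar μ s ≠ ∞ := by
  have h1 := (continuousAt_modulus_one (k := k)).eventually
    (Ioo_mem_nhds (by rw [modulus_one]; norm_num : (1 / 2 : ℝ) < modulus (1 : k))
      (by rw [modulus_one]; norm_num : modulus (1 : k) < 2))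
  obtain ⟨ε, hε, hsub⟩ := Metric.nhds_basis_closedBall.eventually_iff.1 h1
  have hm : MeasurableSet (Metric.closedBall (1 : k) ε) := Metric.isClosed_closedBall.measurableSet
  refine ⟨Metric.closedBall 1 ε, hm, ?_, ?_⟩ <;> rw [mulHaar, withDensity_apply _ hm]
  · have : ∫⁻ _ in Metric.closedBall (1 : k) ε, ENNReal.ofReal 2⁻¹ ∂μ ≤
        ∫⁻ x in Metric.closedBall (1 : k) ε, ENNReal.ofReal (modulus x)⁻¹ ∂μ := by
      refine setLIntegral_mono measurable_ofReal_inv_modulus fun x hx => ENNReal.ofReal_le_ofReal ?_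
      have := hsub hx
      exact inv_anti₀ (by linarith [this.1]) this.2.le
    refine ne_of_gt (lt_of_lt_of_le ?_ this)
    rw [setLIntegral_const]
    exact ENNReal.mul_pos (by simp) (Metric.measure_closedBall_pos μ _ hε).ne'
  · have : ∫⁻ x in Metric.closedBall (1 : k) ε, ENNReal.ofReal (modulus x)⁻¹ ∂μ ≤
        ∫⁻ _ in Metric.closedBall (1 : k) ε, ENNReal.ofReal 2 ∂μ := by
      refine setLIntegral_mono measurable_const fun x hx => ENNReal.ofReal_le_ofReal ?_
      have := hsub hx
      rw [inv_le_comm₀ (by linarith [this.1]) two_pos]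
      linarith [this.1]
    refine ne_of_lt (lt_of_le_of_lt this ?_)
    rw [setLIntegral_const]
    exact ENNReal.mul_lt_top ENNReal.ofReal_lt_top (isCompact_closedBall _ _).measure_lt_top

/-- The usual uniqueness argument for Haar measure: evaluating one double integral in both orders,
using only scaling invariance, compares ∫ w(x) with ∫ w(x⁻¹) up to a common factor. -/
lemma lintegral_mulHaar_comp_inv {f : k → ℝ≥0∞} (hf : Measurable f) :
    ∫⁻ x, f x⁻¹ ∂mulHaar μ = ∫⁻ x, f x ∂mulHaar μ := by
  have key : ∀ F w : k → ℝ≥0∞, Measurable F → Measurable w →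
      (∫⁻ x, F x⁻¹ ∂mulHaar μ) * ∫⁻ x, w x ∂mulHaar μ =
        (∫⁻ x, F x⁻¹ ∂mulHaar μ) * ∫⁻ x, w x⁻¹ ∂mulHaar μ := by
    intro F w hF hw
    calc (∫⁻ x, F x⁻¹ ∂mulHaar μ) * ∫⁻ x, w x ∂mulHaar μ
        = ∫⁻ r, ∫⁻ u, F r⁻¹ * w (r⁻¹ * u) ∂mulHaar μ ∂mulHaar μ := by
          rw [← lintegral_mul_const _ (by fun_prop)]
          refine lintegral_congr_ae ?_
          filter_upwards [ae_mulHaar_ne_zero μ] with r hr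
          rw [lintegral_const_mul _ (by fun_prop),
            lintegral_mulHaar_comp_mul_left μ (inv_ne_zero hr) hw]
      _ = ∫⁻ u, ∫⁻ r, F r⁻¹ * w (r⁻¹ * u) ∂mulHaar μ ∂mulHaar μ :=
          lintegral_lintegral_swap (by fun_prop)
      _ = ∫⁻ u, ∫⁻ r, F (r⁻¹ * u⁻¹) * w r⁻¹ ∂mulHaar μ ∂mulHaar μ := by
          refine lintegral_congr_ae ?_
          filter_upwards [ae_mulHaar_ne_zero μ] with u hu
          rw [← lintegral_mulHaar_comp_mul_left μ hu (f := fun r => F r⁻¹ * w (r⁻¹ * u))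
            (by fun_prop)]
          simp_rw [mul_inv, mul_comm u⁻¹, inv_mul_cancel_right₀ hu]
      _ = ∫⁻ r, ∫⁻ u, F (r⁻¹ * u⁻¹) * w r⁻¹ ∂mulHaar μ ∂mulHaar μ :=
          lintegral_lintegral_swap (by fun_prop)
      _ = (∫⁻ x, F x⁻¹ ∂mulHaar μ) * ∫⁻ x, w x⁻¹ ∂mulHaar μ := by
          rw [← lintegral_const_mul _ (by fun_prop)]
          refine lintegral_congr_ae ?_
          filter_upwards [ae_mulHaar_ne_zero μ] with r hr
          rw [lintegral_mul_const _ (by fun_prop)]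
          congr 1
          simp_rw [← mul_inv]
          exact lintegral_mulHaar_comp_mul_left μ hr (f := fun u => F u⁻¹) (by fun_prop)
  obtain ⟨s, hs, h0, h1⟩ := exists_mulHaar_pos_lt_top μ
  -- F is chosen so that F(x⁻¹) is the indicator of s; the common factor is then the positive finite
  -- measure of s and cancels.
  have h := key (fun x => s.indicator 1 x⁻¹) f
    ((measurable_one.indicator hs).comp measurable_inv) hf
  simp only [inv_inv, lintegral_indicator_one hs] at h
  exact ((ENNReal.mul_right_inj h0 h1).1 h).symm

/-- The image of dx/|x| under squaring and its restriction to the squares are both invariant under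
multiplication by nonzero squares, hence proportional. The cross-multiplied form needs no
finiteness; the constant is found later by a choice of w. -/
lemma lintegral_sq_mul_lintegral_squares [CharZero k] {F w : k → ℝ≥0∞} (hF : Measurable F)
    (hw : Measurable w) :
    (∫⁻ x, F (x ^ 2) ∂mulHaar μ) * ∫⁻ x in nonzeroSquares k, w x ∂mulHaar μ =
      (∫⁻ x, w (x ^ 2) ∂mulHaar μ) * ∫⁻ x in nonzeroSquares k, F x ∂mulHaar μ := by
  have hS : MeasurableSet (nonzeroSquares k) := isOpen_nonzeroSquares.measurableSet
  have scale : ∀ (f : k → ℝ≥0∞) (a : k), Measurable f → a ≠ 0 →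
      ∫⁻ x in nonzeroSquares k, f (a ^ 2 * x) ∂mulHaar μ =
        ∫⁻ x in nonzeroSquares k, f x ∂mulHaar μ := by
    intro f a hf ha
    rw [← lintegral_indicator hS, ← lintegral_indicator hS,
      ← lintegral_mulHaar_comp_mul_left μ (pow_ne_zero 2 ha) (hf.indicator hS)]
    congr 1 with x
    by_cases hx : x ∈ nonzeroSquares k <;> simp [hx, mul_mem_nonzeroSquares ha]
  have inv : ∀ f : k → ℝ≥0∞, Measurable f →
      ∫⁻ x in nonzeroSquares k, f x⁻¹ ∂mulHaar μ = ∫⁻ x in nonzeroSquares k, f x ∂mulHaar μ := by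
    intro f hf
    rw [← lintegral_indicator hS, ← lintegral_indicator hS,
      ← lintegral_mulHaar_comp_inv μ (hf.indicator hS)]
    congr 1 with x
    by_cases hx : x ∈ nonzeroSquares k <;> simp [hx, inv_mem_nonzeroSquares]
  calc (∫⁻ x, F (x ^ 2) ∂mulHaar μ) * ∫⁻ x in nonzeroSquares k, w x ∂mulHaar μ
      = ∫⁻ r, ∫⁻ u in nonzeroSquares k, F (r ^ 2) * w (r ^ 2 * u⁻¹) ∂mulHaar μ ∂mulHaar μ := by
        rw [← lintegral_mul_const _ (by fun_prop)]
        refine lintegral_congr_ae ?_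
        filter_upwards [ae_mulHaar_ne_zero μ] with r hr
        rw [lintegral_const_mul _ (by fun_prop), inv (fun u => w (r ^ 2 * u)) (by fun_prop),
          scale w r hw hr]
    _ = ∫⁻ u in nonzeroSquares k, ∫⁻ r, F (r ^ 2) * w (r ^ 2 * u⁻¹) ∂mulHaar μ ∂mulHaar μ :=
        lintegral_lintegral_swap (by fun_prop)
    _ = ∫⁻ u in nonzeroSquares k, ∫⁻ r, F (r ^ 2 * u) * w (r ^ 2) ∂mulHaar μ ∂mulHaar μ := by
        -- For u = s² the substitution r ↦ sr moves u from the argument of w to that of F.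
        refine setLIntegral_congr_fun hS ?_
        rintro u ⟨s, hs, rfl⟩
        simp only
        rw [← lintegral_mulHaar_comp_mul_left μ hs
          (f := fun r => F (r ^ 2) * w (r ^ 2 * (s ^ 2)⁻¹)) (by fun_prop)]
        simp_rw [mul_pow, mul_comm (s ^ 2), mul_inv_cancel_right₀ (pow_ne_zero 2 hs)]
    _ = ∫⁻ r, ∫⁻ u in nonzeroSquares k, F (r ^ 2 * u) * w (r ^ 2) ∂mulHaar μ ∂mulHaar μ :=
        lintegral_lintegral_swap (by fun_prop)
    _ = (∫⁻ x, w (x ^ 2) ∂mulHaar μ) * ∫⁻ x in nonzeroSquares k, F x ∂mulHaar μ := by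
        rw [← lintegral_mul_const _ (by fun_prop)]
        refine lintegral_congr_ae ?_
        filter_upwards [ae_mulHaar_ne_zero μ] with r hr
        rw [lintegral_mul_const _ (by fun_prop), scale F r hF hr, mul_comm]

end Multiplicative

/-! ### The constant 2|2|⁻¹ in the change of variables u = r². -/

section SquareMap

variable {k : Type*} [NontriviallyNormedField k] [LocallyCompactSpace k]
  [MeasurableSpace k] [BorelSpace k]

lemma modulus_neg (a : k) : modulus (-a) = modulus a :=
  le_antisymm (modulus_le_of_norm_le (norm_neg a).le) (modulus_le_of_norm_le (norm_neg a).ge)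

variable (μ : Measure k) [μ.IsAddHaarMeasure]

lemma lintegral_eq_modulus_mul_lintegral_comp_affine {a : k} (ha : a ≠ 0) (b : k)
    (f : k → ℝ≥0∞) :
    ∫⁻ x, f x ∂μ = ENNReal.ofReal (modulus a) * ∫⁻ x, f (b + a * x) ∂μ := by
  rw [lintegral_comp_mul_left μ ha (fun x => f (b + x)), lintegral_add_left_eq_self f b,
    ← mul_assoc, ← ENNReal.ofReal_mul (modulus_nonneg a), mul_inv_cancel₀ (modulus_pos ha).ne',
    ENNReal.ofReal_one, one_mul]

/-- Multiplicative change of variables for the squaring map. -/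
theorem lintegral_mulHaar_comp_sq [CharZero k] {F : k → ℝ≥0∞} (hF : Measurable F) :
    ∫⁻ x, F (x ^ 2) ∂mulHaar μ =
      ENNReal.ofReal (2 * (modulus (2 : k))⁻¹) * ∫⁻ x in nonzeroSquares k, F x ∂mulHaar μ := by
  have h2 : (2 : k) ≠ 0 := two_ne_zero
  have h2' : 0 < ‖(2 : k)‖ := norm_pos_iff.2 h2
  have hmod := (continuousAt_modulus_one (k := k)).eventually
    (lt_mem_nhds (by rw [modulus_one]; norm_num : (1 / 2 : ℝ) < modulus (1 : k)))
  obtain ⟨ε₀, hε₀, hsub⟩ := Metric.nhds_basis_ball.eventually_iff.1 hmod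
  -- ε ≤ ε₀ bounds |x|⁻¹ on the ball U around 1; ε ≤ ‖2‖/2 makes U and -U disjoint and later keeps
  -- ‖2 + lx‖ ≥ ‖2‖/2; ε ≤ 1 keeps 0 out of U.
  obtain ⟨ε, hε, hεε₀, hε2, hε1⟩ : ∃ ε : ℝ, 0 < ε ∧ ε ≤ ε₀ ∧ ε ≤ ‖(2 : k)‖ / 2 ∧ ε ≤ 1 :=
    ⟨min ε₀ (min (‖(2 : k)‖ / 2) 1), by positivity, min_le_left _ _,
      (min_le_right _ _).trans (min_le_left _ _), (min_le_right _ _).trans (min_le_right _ _)⟩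
  set U : Set k := Metric.ball 1 ε with hU
  have hUm : ∀ x ∈ U, (1 / 2 : ℝ) < modulus x := fun x hx => hsub (Metric.ball_subset_ball hεε₀ hx)
  have hUm' : ∀ x ∈ U, (modulus x)⁻¹ ≤ 2 := fun x hx => by
    rw [inv_le_comm₀ (by linarith [hUm x hx]) two_pos]; linarith [hUm x hx]
  have hU0 : (0 : k) ∉ U := by simp [hU, hε1]
  have hUneg : ∀ x ∈ U, -x ∉ U := by
    intro x hx hx'
    rw [hU, Metric.mem_ball, dist_eq_norm] at hx hx'
    have : ‖(2 : k)‖ ≤ ‖x - 1‖ + ‖-x - 1‖ := by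
      rw [← norm_neg (2 : k)]
      refine le_trans (le_of_eq ?_) (norm_add_le _ _)
      congr 1; ring
    linarith
  set T : Set k := (fun x : k => x ^ 2) '' U with hT
  have hTo : IsOpen T := image_sq_isOpen Metric.isOpen_ball hU0
  have hTmem : ∀ r : k, r ^ 2 ∈ T ↔ r ∈ U ∨ -r ∈ U := by
    intro r
    constructor
    · rintro ⟨s, hs, h⟩
      rcases sq_eq_sq_iff_eq_or_eq_neg.1 h with rfl | rfl
      · exact Or.inl hs
      · exact Or.inr (by simpa using hs)
    · rintro (h | h)
      · exact ⟨r, h, rfl⟩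
      · exact ⟨-r, h, by simp⟩
  have hTm : ∀ u ∈ T, (modulus u)⁻¹ ≤ 4 := by
    rintro _ ⟨r, hr, rfl⟩
    have h1 := hUm' r hr
    have h0 : 0 ≤ (modulus r)⁻¹ := inv_nonneg.2 (modulus_nonneg r)
    simp only [modulus_pow, ← inv_pow]
    nlinarith
  have hTS : T ⊆ nonzeroSquares k := by
    rintro _ ⟨r, hr, rfl⟩
    exact ⟨r, fun h => hU0 (h ▸ hr), rfl⟩
  -- A tent supported in the unit ball: continuous, with positive finite integral.
  set g : k → ℝ≥0∞ := fun y => ENNReal.ofReal (1 - ‖y‖) with hg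
  have hgc : Continuous g := ENNReal.continuous_ofReal.comp (by fun_prop)
  have hg1 : ∀ y, g y ≤ 1 := fun y => by simp [hg]
  have hg0 : ∀ y, 1 < ‖y‖ → g y = 0 := fun y hy => by simp [hg, hy.le]
  have hgint0 : ∫⁻ y, g y ∂μ ≠ 0 := by
    rw [Ne, lintegral_eq_zero_iff hgc.measurable]
    intro h
    have := congrFun ((hgc.ae_eq_iff_eq (μ := μ) (continuous_const (y := 0))).1 h) 0
    simp [hg] at this
  have hball : ∀ R : ℝ, μ (Metric.closedBall (0 : k) R) ≠ ∞ :=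
    fun R => (isCompact_closedBall _ _).measure_ne_top
  have hbound : ∀ (C : ℝ≥0∞) (R : ℝ), C ≠ ∞ →
      ∫⁻ y, (Metric.closedBall (0 : k) R).indicator (fun _ => C) y ∂μ ≠ ∞ := by
    intro C R hC
    rw [lintegral_indicator_const Metric.isClosed_closedBall.measurableSet]
    exact ENNReal.mul_ne_top hC (hball R)
  have hgint1 : ∫⁻ y, g y ∂μ ≠ ∞ := by
    refine ne_top_of_le_ne_top (hbound 1 1 one_ne_top) (lintegral_mono fun y => ?_)
    by_cases hy : ‖y‖ ≤ 1
    · simpa [hy] using hg1 y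
    · simp [hg0 y (not_le.1 hy)]
  -- the test functions concentrating at `1`
  let w : k → k → ℝ≥0∞ := fun l => T.indicator fun u => g ((u - 1) / l)
  have hwm : ∀ l, Measurable (w l) := fun l =>
    Measurable.indicator (by fun_prop) hTo.measurableSet
  -- A and B are what remains of the two integrals of w l once the substitution 1 + lx has released
  -- a factor |l|. The 2 in A counts the two square roots, one in U and one in -U.
  let A : k → ℝ≥0∞ := fun l => 2 * ∫⁻ x, U.indicator
    (fun r => ENNReal.ofReal (modulus r)⁻¹ * g ((r ^ 2 - 1) / l)) (1 + l * x) ∂μ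
  let B : k → ℝ≥0∞ := fun l => ∫⁻ x, T.indicator
    (fun u => ENNReal.ofReal (modulus u)⁻¹ * g ((u - 1) / l)) (1 + l * x) ∂μ
  have hindU : ∀ l : k, Measurable
      (U.indicator fun r => ENNReal.ofReal (modulus r)⁻¹ * g ((r ^ 2 - 1) / l)) := fun l =>
    (measurable_ofReal_inv_modulus.mul (by fun_prop)).indicator Metric.isOpen_ball.measurableSet
  have hindT : ∀ l : k, Measurable
      (T.indicator fun u => ENNReal.ofReal (modulus u)⁻¹ * g ((u - 1) / l)) := fun l =>
    (measurable_ofReal_inv_modulus.mul (by fun_prop)).indicator hTo.measurableSet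
  have hA : ∀ l : k, l ≠ 0 →
      ∫⁻ x, w l (x ^ 2) ∂mulHaar μ = ENNReal.ofReal (modulus l) * A l := by
    intro l hl
    rw [lintegral_mulHaar μ (f := fun x => w l (x ^ 2)) ((hwm l).comp (by fun_prop))]
    have h : ∀ r : k, ENNReal.ofReal (modulus r)⁻¹ * w l (r ^ 2) =
        U.indicator (fun r => ENNReal.ofReal (modulus r)⁻¹ * g ((r ^ 2 - 1) / l)) r +
        U.indicator (fun r => ENNReal.ofReal (modulus r)⁻¹ * g ((r ^ 2 - 1) / l)) (-r) := by
      intro r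
      by_cases h1 : r ∈ U
      · have h3 : r ^ 2 ∈ T := (hTmem r).2 (Or.inl h1)
        simp [w, h1, hUneg r h1, h3]
      by_cases h2 : -r ∈ U
      · have h3 : r ^ 2 ∈ T := (hTmem r).2 (Or.inr h2)
        simp [w, h1, h2, h3, modulus_neg]
      · have h3 : r ^ 2 ∉ T := fun h => ((hTmem r).1 h).elim h1 h2
        simp [w, h1, h2, h3]
    simp_rw [h]
    rw [lintegral_add_left (hindU l), lintegral_neg_eq_self
      (U.indicator fun r => ENNReal.ofReal (modulus r)⁻¹ * g ((r ^ 2 - 1) / l)), ← two_mul,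
      lintegral_eq_modulus_mul_lintegral_comp_affine μ hl 1, mul_left_comm]
  have hB : ∀ l : k, l ≠ 0 →
      ∫⁻ x in nonzeroSquares k, w l x ∂mulHaar μ = ENNReal.ofReal (modulus l) * B l := by
    intro l hl
    rw [setLIntegral_eq_of_support_subset, lintegral_mulHaar μ (hwm l)]
    · have h : ∀ u, ENNReal.ofReal (modulus u)⁻¹ * w l u =
          T.indicator (fun u => ENNReal.ofReal (modulus u)⁻¹ * g ((u - 1) / l)) u := by
        intro u
        by_cases hu : u ∈ T <;> simp [w, hu]
      simp_rw [h]
      exact lintegral_eq_modulus_mul_lintegral_comp_affine μ hl 1 _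
    · exact Set.support_indicator_subset.trans hTS
  have hlim1 : ∀ x : k, Tendsto (fun l : k => 1 + l * x) (𝓝[≠] 0) (𝓝 1) := by
    intro x
    have : Tendsto (fun l : k => 1 + l * x) (𝓝 0) (𝓝 (1 + 0 * x)) :=
      Continuous.tendsto (by fun_prop) 0
    rw [zero_mul, add_zero] at this
    exact this.mono_left nhdsWithin_le_nhds
  have hlimmod : ∀ x : k, Tendsto (fun l : k => ENNReal.ofReal (modulus (1 + l * x))⁻¹)
      (𝓝[≠] 0) (𝓝 1) := by
    intro x
    have h := (continuousAt_modulus_one (k := k)).tendsto.comp (hlim1 x)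
    rw [modulus_one] at h
    have := ENNReal.tendsto_ofReal (h.inv₀ one_ne_zero)
    simpa using this
  -- Since ((1 + lx)² - 1)/l = x(2 + lx) tends to 2x, the derivative of squaring at 1 appears. On U
  -- one has ‖2 + lx‖ ≥ ‖2‖/2, so all integrands live in a fixed ball, which gives domination.
  have hAlim : Tendsto A (𝓝[≠] 0) (𝓝 (2 * ∫⁻ x, g (2 * x) ∂μ)) := by
    refine ENNReal.Tendsto.const_mul ?_ (Or.inr ofNat_ne_top)
    refine tendsto_lintegral_filter_of_dominated_convergence
      ((Metric.closedBall (0 : k) (2 / ‖(2 : k)‖)).indicator fun _ => 2)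
      (Eventually.of_forall fun l => (hindU l).comp (by fun_prop)) ?_ (hbound _ _ ofNat_ne_top) ?_
    · filter_upwards [self_mem_nhdsWithin] with l (hl : l ≠ 0)
      refine Eventually.of_forall fun x => ?_
      by_cases hx : 1 + l * x ∈ U
      · rw [Set.indicator_of_mem hx]
        have hlx : ‖l * x‖ < ε := by simpa [hU, dist_eq_norm] using hx
        have he : ((1 + l * x) ^ 2 - 1) / l = x * (2 + l * x) := by field_simp; ring
        rw [he]
        by_cases hx2 : ‖x‖ ≤ 2 / ‖(2 : k)‖
        · rw [Set.indicator_of_mem (by simpa using hx2)]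
          calc _ ≤ ENNReal.ofReal 2 * 1 := by
                gcongr
                · exact hUm' _ hx
                · exact hg1 _
            _ = 2 := by simp
        · rw [hg0, mul_zero]
          · exact zero_le
          rw [not_le, div_lt_iff₀ h2'] at hx2
          have h4 : ‖(2 : k)‖ / 2 ≤ ‖2 + l * x‖ := by
            have := norm_sub_le (2 + l * x) (l * x)
            rw [add_sub_cancel_right] at this
            linarith
          rw [norm_mul]
          nlinarith [norm_nonneg x]
      · rw [Set.indicator_of_notMem hx]
        exact zero_le
    · refine Eventually.of_forall fun x => ?_
      have h1 : Tendsto (fun l : k => g (x * (2 + l * x))) (𝓝[≠] 0) (𝓝 (g (2 * x))) := by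
        have : Tendsto (fun l : k => g (x * (2 + l * x))) (𝓝 0) (𝓝 (g (x * (2 + 0 * x)))) :=
          Continuous.tendsto (by fun_prop) 0
        rw [zero_mul, add_zero, mul_comm x 2] at this
        exact this.mono_left nhdsWithin_le_nhds
      have h2 := ENNReal.Tendsto.mul (hlimmod x) (Or.inl one_ne_zero) h1 (Or.inr one_ne_top)
      rw [one_mul] at h2
      refine h2.congr' ?_
      filter_upwards [self_mem_nhdsWithin, (hlim1 x).eventually (Metric.ball_mem_nhds 1 hε)]
        with l (hl : l ≠ 0) (hx : 1 + l * x ∈ U)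
      have he : ((1 + l * x) ^ 2 - 1) / l = x * (2 + l * x) := by field_simp; ring
      rw [Set.indicator_of_mem hx, he]
  have hBlim : Tendsto B (𝓝[≠] 0) (𝓝 (∫⁻ x, g x ∂μ)) := by
    refine tendsto_lintegral_filter_of_dominated_convergence
      ((Metric.closedBall (0 : k) 1).indicator fun _ => 4)
      (Eventually.of_forall fun l => (hindT l).comp (by fun_prop)) ?_ (hbound _ _ ofNat_ne_top) ?_
    · filter_upwards [self_mem_nhdsWithin] with l (hl : l ≠ 0)
      refine Eventually.of_forall fun x => ?_
      by_cases hx : 1 + l * x ∈ T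
      · rw [Set.indicator_of_mem hx, add_sub_cancel_left, mul_div_cancel_left₀ _ hl]
        by_cases hx2 : ‖x‖ ≤ 1
        · rw [Set.indicator_of_mem (by simpa using hx2)]
          calc _ ≤ ENNReal.ofReal 4 * 1 := by
                gcongr
                · exact hTm _ hx
                · exact hg1 _
            _ = 4 := by simp
        · rw [hg0 x (not_le.1 hx2), mul_zero]
          exact zero_le
      · rw [Set.indicator_of_notMem hx]
        exact zero_le
    · refine Eventually.of_forall fun x => ?_
      have h2 := ENNReal.Tendsto.mul_const (b := g x) (hlimmod x) (Or.inl one_ne_zero)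
      rw [one_mul] at h2
      have hT1 : T ∈ 𝓝 (1 : k) := hTo.mem_nhds ⟨1, Metric.mem_ball_self hε, one_pow 2⟩
      refine h2.congr' ?_
      filter_upwards [self_mem_nhdsWithin, (hlim1 x).eventually hT1] with l
        (hl : l ≠ 0) (hx : 1 + l * x ∈ T)
      rw [Set.indicator_of_mem hx, add_sub_cancel_left, mul_div_cancel_left₀ _ hl]
  -- Proportionality with w = w l, divided by |l|, in the limit l → 0.
  have hlimeq : (∫⁻ x, F (x ^ 2) ∂mulHaar μ) * ∫⁻ x, g x ∂μ =
      (2 * ∫⁻ x, g (2 * x) ∂μ) * ∫⁻ x in nonzeroSquares k, F x ∂mulHaar μ := by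
    have hgint2 : 2 * ∫⁻ x, g (2 * x) ∂μ ≠ 0 := by
      rw [lintegral_comp_mul_left μ h2]
      simp [hgint0, modulus_pos h2]
    refine tendsto_nhds_unique (ENNReal.Tendsto.const_mul hBlim (Or.inl hgint0)) ?_
    refine (ENNReal.Tendsto.mul_const hAlim (Or.inl hgint2)).congr' ?_
    filter_upwards [self_mem_nhdsWithin] with l (hl : l ≠ 0)
    have h := lintegral_sq_mul_lintegral_squares μ hF (hwm l)
    rw [hA l hl, hB l hl, mul_left_comm, mul_assoc] at h
    exact ((ENNReal.mul_right_inj (by simpa using modulus_pos hl) ENNReal.ofReal_ne_top).1 h).symm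
  rw [lintegral_comp_mul_left μ h2] at hlimeq
  refine (ENNReal.mul_left_inj hgint0 hgint1).1 ?_
  rw [hlimeq, ENNReal.ofReal_mul two_pos.le, ENNReal.ofReal_ofNat]
  ring

/-- The image of Haar measure under the squaring map. -/
theorem map_sq_haar [CharZero k] :
    μ.map (fun x => x ^ 2) = (μ.restrict (nonzeroSquares k)).withDensity fun u =>
      ENNReal.ofReal (2 * (modulus (2 : k))⁻¹ * modulus u ^ (-(1 / 2) : ℝ)) := by
  have hS : MeasurableSet (nonzeroSquares k) := isOpen_nonzeroSquares.measurableSet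
  have hmm : Measurable (modulus : k → ℝ) := measurable_modulus
  have hdm : Measurable fun u : k =>
      ENNReal.ofReal (2 * (modulus (2 : k))⁻¹ * modulus u ^ (-(1 / 2) : ℝ)) := by fun_prop
  ext s hs
  rw [← lintegral_indicator_one hs, ← lintegral_indicator_one hs,
    lintegral_map (measurable_one.indicator hs) (by fun_prop),
    lintegral_withDensity_eq_lintegral_mul _ hdm (measurable_one.indicator hs)]
  set f : k → ℝ≥0∞ := s.indicator 1 with hf
  have hfm : Measurable f := measurable_one.indicator hs
  -- The weight |u|^{1/2} equals |x| at u = x² and cancels the density 1/|x|.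
  have h := lintegral_mulHaar_comp_sq μ
    (F := fun u => ENNReal.ofReal (modulus u ^ (1 / 2 : ℝ)) * f u) (by fun_prop)
  rw [lintegral_mulHaar μ (by fun_prop)] at h
  have hne : ∀ᵐ x ∂μ, x ≠ 0 := by simp [ae_iff]
  have hl : ∫⁻ x, f (x ^ 2) ∂μ = ∫⁻ x, ENNReal.ofReal (modulus x)⁻¹ *
      (ENNReal.ofReal (modulus (x ^ 2) ^ (1 / 2 : ℝ)) * f (x ^ 2)) ∂μ := by
    refine lintegral_congr_ae ?_
    filter_upwards [hne] with x hx
    have hp := modulus_pos hx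
    rw [← mul_assoc, ← ENNReal.ofReal_mul (inv_nonneg.2 hp.le), modulus_pow, ← Real.sqrt_eq_rpow,
      Real.sqrt_sq hp.le, inv_mul_cancel₀ hp.ne', ENNReal.ofReal_one, one_mul]
  rw [hl, h, ← lintegral_const_mul _ (by fun_prop), ← lintegral_indicator hS,
    ← lintegral_indicator hS, lintegral_mulHaar μ (Measurable.indicator (by fun_prop) hS)]
  refine lintegral_congr fun u => ?_
  by_cases hu : u ∈ nonzeroSquares k
  · have hu0 : u ≠ 0 := by obtain ⟨r, hr, rfl⟩ := hu; exact pow_ne_zero 2 hr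
    have hp := modulus_pos hu0
    have hp2 := modulus_nonneg (2 : k)
    simp only [Set.indicator_of_mem hu, Pi.mul_apply]
    rw [← mul_assoc, ← mul_assoc, ← ENNReal.ofReal_mul (by positivity),
      ← ENNReal.ofReal_mul (by positivity)]
    congr 2
    have : modulus u ^ (-(1 / 2) : ℝ) = (modulus u)⁻¹ * modulus u ^ (1 / 2 : ℝ) := by
      rw [← Real.rpow_neg_one, ← Real.rpow_add hp]; norm_num
    rw [this]; ring
  · simp [hu]

end SquareMap

/-! ### Integrability of |t|⁻² at infinity and dilations of V. -/

section Scaling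

variable {k : Type*} [NontriviallyNormedField k] [LocallyCompactSpace k]
  [MeasurableSpace k] [BorelSpace k]

/-- Inversion preserves dt/|t|, so it turns |t|⁻² dt at infinity into dt on a subset of the unit
ball, which has finite measure. -/
lemma lintegral_inv_modulus_sq_lt_top (μ : Measure k) [μ.IsAddHaarMeasure] :
    ∫⁻ t in {t : k | 1 < ‖t‖}, ENNReal.ofReal (modulus t ^ 2)⁻¹ ∂μ < ∞ := by
  have hmm : Measurable (modulus : k → ℝ) := measurable_modulus
  have hS : MeasurableSet {t : k | 1 < ‖t‖} := measurableSet_lt measurable_const measurable_norm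
  have h1 : Measurable ({t : k | 1 < ‖t‖}.indicator fun t => ENNReal.ofReal (modulus t)⁻¹) :=
    measurable_ofReal_inv_modulus.indicator hS
  calc ∫⁻ t in {t : k | 1 < ‖t‖}, ENNReal.ofReal (modulus t ^ 2)⁻¹ ∂μ
      = ∫⁻ t, {t : k | 1 < ‖t‖}.indicator (fun t => ENNReal.ofReal (modulus t)⁻¹) t
          ∂mulHaar μ := by
        rw [lintegral_mulHaar μ h1, ← lintegral_indicator hS]
        refine lintegral_congr fun t => ?_
        by_cases ht : t ∈ {t : k | 1 < ‖t‖}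
        · rw [Set.indicator_of_mem ht, Set.indicator_of_mem ht, ← ENNReal.ofReal_mul
            (inv_nonneg.2 (modulus_nonneg t)), ← mul_inv, sq]
        · rw [Set.indicator_of_notMem ht, Set.indicator_of_notMem ht, mul_zero]
    _ = ∫⁻ t, {t : k | 1 < ‖t‖}.indicator (fun t => ENNReal.ofReal (modulus t)⁻¹) t⁻¹
          ∂mulHaar μ := (lintegral_mulHaar_comp_inv μ h1).symm
    _ = ∫⁻ t, ENNReal.ofReal (modulus t)⁻¹ *
          {t : k | 1 < ‖t‖}.indicator (fun t => ENNReal.ofReal (modulus t)⁻¹) t⁻¹ ∂μ :=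
        lintegral_mulHaar μ (h1.comp measurable_inv)
    _ ≤ ∫⁻ t, (Metric.closedBall (0 : k) 1).indicator 1 t ∂μ := by
        refine lintegral_mono fun t => ?_
        by_cases ht : t⁻¹ ∈ {t : k | 1 < ‖t‖}
        · have ht0 : t ≠ 0 := by
            rintro rfl
            simp at ht
            linarith
          have ht1 : t ∈ Metric.closedBall (0 : k) 1 := by
            rw [Set.mem_ofPred_eq, norm_inv, one_lt_inv₀ (norm_pos_iff.2 ht0)] at ht
            simpa using ht.le
          rw [Set.indicator_of_mem ht, Set.indicator_of_mem ht1, modulus_inv, inv_inv,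
            ← ENNReal.ofReal_mul (inv_nonneg.2 (modulus_nonneg t)),
            inv_mul_cancel₀ (modulus_pos ht0).ne']
          simp
        · rw [Set.indicator_of_notMem ht, mul_zero]
          exact zero_le
    _ < ∞ := by
        rw [lintegral_indicator_one Metric.isClosed_closedBall.measurableSet]
        exact (isCompact_closedBall _ _).measure_lt_top

variable (k) in
/-- Coordinates on a finite-dimensional vector space. -/
noncomputable def coords (V : Type*) [AddCommGroup V] [Module k V] [FiniteDimensional k V]
    [TopologicalSpace V] [IsTopologicalAddGroup V] [ContinuousSMul k V] [T2Space V] :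
    V ≃L[k] (Fin (Module.finrank k V) → k) :=
  ContinuousLinearEquiv.ofFinrankEq (by simp)

variable {V : Type*} [AddCommGroup V] [Module k V] [FiniteDimensional k V]
  [TopologicalSpace V] [IsTopologicalAddGroup V] [ContinuousSMul k V] [T2Space V]

lemma secondCountable_of_finiteDimensional (k V : Type*) [NontriviallyNormedField k]
    [LocallyCompactSpace k] [AddCommGroup V] [Module k V] [FiniteDimensional k V]
    [TopologicalSpace V] [IsTopologicalAddGroup V] [ContinuousSMul k V] [T2Space V] :
    SecondCountableTopology V :=
  (coords k V).toHomeomorph.secondCountableTopology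

lemma locallyCompact_of_finiteDimensional (k V : Type*) [NontriviallyNormedField k]
    [LocallyCompactSpace k] [AddCommGroup V] [Module k V] [FiniteDimensional k V]
    [TopologicalSpace V] [IsTopologicalAddGroup V] [ContinuousSMul k V] [T2Space V] :
    LocallyCompactSpace V :=
  (coords k V).toHomeomorph.isClosedEmbedding.locallyCompactSpace

lemma map_smul_pi (ι : Type*) [Fintype ι] (μ : Measure k) [μ.IsAddHaarMeasure] {a : k}
    (ha : a ≠ 0) :
    (Measure.pi fun _ : ι => μ).map (fun x => a • x) =
      ENNReal.ofReal (modulus a ^ Fintype.card ι)⁻¹ • Measure.pi fun _ : ι => μ := by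
  have hp := modulus_pos ha
  have h : (Measure.pi fun _ : ι => μ) = ENNReal.ofReal (modulus a ^ Fintype.card ι) •
      (Measure.pi fun _ : ι => μ).map (fun x => a • x) := by
    refine Measure.pi_eq fun s hs => ?_
    rw [Measure.smul_apply, Measure.map_apply (measurable_const_smul a)
      (MeasurableSet.univ_pi hs)]
    have : (fun x : ι → k => a • x) ⁻¹' Set.univ.pi s =
        Set.univ.pi fun i => (fun x => a * x) ⁻¹' s i := by ext; simp
    rw [this, Measure.pi_pi]
    have h2 : ∀ i, μ ((fun x => a * x) ⁻¹' s i) = ENNReal.ofReal (modulus a)⁻¹ * μ (s i) := by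
      intro i
      rw [← Measure.map_apply (measurable_const_mul a) (hs i), map_mul_left_haar μ ha]
      rfl
    simp_rw [h2]
    rw [Finset.prod_mul_distrib, Finset.prod_const, Finset.card_univ, smul_eq_mul, ← mul_assoc,
      ← ENNReal.ofReal_pow (inv_nonneg.2 hp.le), ← ENNReal.ofReal_mul (by positivity), inv_pow,
      mul_inv_cancel₀ (by positivity), ENNReal.ofReal_one, one_mul]
  conv_rhs => rw [h]
  rw [smul_smul, ← ENNReal.ofReal_mul (by positivity), inv_mul_cancel₀ (by positivity),
    ENNReal.ofReal_one, one_smul]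

variable [MeasurableSpace V] [BorelSpace V]

/-- By uniqueness of Haar measure ν is a multiple of a product measure transported through
coordinates, where the factor is computed coordinate by coordinate. -/
lemma map_smul_haar (ν : Measure V) [ν.IsAddHaarMeasure] {a : k} (ha : a ≠ 0) :
    ν.map (fun X => a • X) = ENNReal.ofReal (modulus a ^ Module.finrank k V)⁻¹ • ν := by
  obtain ⟨μ, _⟩ := exists_isAddHaarMeasure k
  have : SecondCountableTopology V := secondCountable_of_finiteDimensional k V
  have : LocallyCompactSpace V := locallyCompact_of_finiteDimensional k V
  set e := coords k V
  set ρ : Measure V := (Measure.pi fun _ : Fin (Module.finrank k V) => μ).map e.symm with hρ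
  have : ρ.IsAddHaarMeasure := e.symm.isAddHaarMeasure_map _
  have hρs : ρ.map (fun X => a • X) =
      ENNReal.ofReal (modulus a ^ Module.finrank k V)⁻¹ • ρ := by
    have h := map_smul_pi (Fin (Module.finrank k V)) μ ha
    rw [Fintype.card_fin] at h
    rw [hρ, Measure.map_map (measurable_const_smul a) e.symm.continuous.measurable,
      ← Measure.map_smul, ← h, Measure.map_map e.symm.continuous.measurable
      (measurable_const_smul a)]
    congr 1
    ext x
    simp
  rw [Measure.isAddLeftInvariant_eq_smul ν ρ, Measure.map_smul, hρs, smul_comm]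

lemma lintegral_comp_smul (ν : Measure V) [ν.IsAddHaarMeasure] {a : k} (ha : a ≠ 0)
    (f : V → ℝ≥0∞) :
    ∫⁻ X, f (a • X) ∂ν =
      ENNReal.ofReal (modulus a ^ Module.finrank k V)⁻¹ * ∫⁻ X, f X ∂ν := by
  rw [← smul_eq_mul, ← lintegral_smul_measure, ← map_smul_haar ν ha]
  exact ((Homeomorph.smulOfNeZero a ha).measurableEmbedding.lintegral_map _).symm

end Scaling

/-! ### Elementary facts on unitary characters. -/

section CharacterIntegrals

variable {k : Type*} [NontriviallyNormedField k] {ψ : AddChar k Circle}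

lemma char_add (a b : k) : (ψ (a + b) : ℂ) = ψ a * ψ b := by
  rw [AddChar.map_add_eq_mul, Circle.coe_mul]

lemma conj_char (a : k) : conj (ψ a : ℂ) = ψ (-a) := by
  rw [AddChar.map_neg_eq_inv, Circle.coe_inv_eq_conj]

@[simp]
lemma norm_char (a : k) : ‖(ψ a : ℂ)‖ = 1 := Circle.norm_coe _

@[simp]
lemma enorm_char (a : k) : ‖(ψ a : ℂ)‖ₑ = 1 := by
  rw [← ofReal_norm, norm_char, ENNReal.ofReal_one]

lemma continuous_char (hψ : Continuous ψ) : Continuous fun a => (ψ a : ℂ) :=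
  continuous_subtype_val.comp hψ

variable {V : Type*} [AddCommGroup V] [Module k V] [MeasurableSpace V] {ν : Measure V}

lemma enorm_fourierQuad_le (q : QuadraticForm k V) (f : V → ℂ) (t : k) :
    ‖fourierQuad ψ q ν f t‖ₑ ≤ ∫⁻ y, ‖f y‖ₑ ∂ν := by
  refine (enorm_integral_le_lintegral_enorm _).trans (le_of_eq ?_)
  simp [enorm_mul]

variable [MeasurableSpace k] [BorelSpace k]

lemma measurable_char (hψ : Continuous ψ) : Measurable fun a => (ψ a : ℂ) :=
  (continuous_char hψ).measurable

lemma integrable_mul_char {α : Type*} [MeasurableSpace α] {m : Measure α} (hψ : Continuous ψ)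
    {f : α → ℂ} (hf : Integrable f m) {c : α → k} (hc : Measurable c) :
    Integrable (fun x => f x * (ψ (c x) : ℂ)) m := by
  refine hf.mono (hf.1.mul ((measurable_char hψ).comp hc).aestronglyMeasurable) ?_
  exact Eventually.of_forall fun x => by simp

end CharacterIntegrals

/-! ### Decay and square integrability of F_qφ. -/

section Decay

variable {k : Type*} [NontriviallyNormedField k] [LocallyCompactSpace k]
  {V : Type*} [AddCommGroup V] [Module k V] [FiniteDimensional k V]
  [TopologicalSpace V] [IsTopologicalAddGroup V] [ContinuousSMul k V] [T2Space V]

lemma continuous_bilin (B : LinearMap.BilinForm k V) :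
    Continuous fun p : V × V => B p.1 p.2 := by
  let e := coords k V
  let b := (Pi.basisFun k (Fin (Module.finrank k V))).map e.symm.toLinearEquiv
  have h : (fun p : V × V => B p.1 p.2) =
      fun p => ∑ i, ∑ j, e p.1 i * e p.2 j * B (b i) (b j) := by
    ext p
    have hx : ∀ x : V, x = ∑ i, e x i • b i := fun x => by
      conv_lhs => rw [← b.sum_repr x]
      simp [b]
    conv_lhs => rw [hx p.1, hx p.2]
    simp only [map_sum, map_smul, LinearMap.sum_apply, LinearMap.smul_apply, smul_eq_mul,
      Finset.mul_sum, mul_assoc]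
    rw [Finset.sum_comm]
    exact Finset.sum_congr rfl fun i _ => Finset.sum_congr rfl fun j _ => mul_left_comm _ _ _
  rw [h]
  have he : Continuous e := e.continuous
  fun_prop

lemma continuous_quadraticForm [CharZero k] (q : QuadraticForm k V) : Continuous q := by
  have h : (q : V → k) = fun X => 2⁻¹ * QuadraticMap.polarBilin q X X := by
    ext X
    rw [QuadraticMap.polarBilin_apply_apply, QuadraticMap.polar_self, nsmul_eq_mul, Nat.cast_ofNat]
    rw [inv_mul_cancel_left₀ two_ne_zero]
  rw [h]
  exact continuous_const.mul ((continuous_bilin q.polarBilin).comp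
    (by fun_prop : Continuous fun X : V => (X, X)))

variable [MeasurableSpace k] [BorelSpace k] [MeasurableSpace V] [BorelSpace V]
  {ψ : AddChar k Circle} {ν : Measure V}

lemma continuous_bilinFourier (hψ : Continuous ψ) (B : LinearMap.BilinForm k V) {f : V → ℂ}
    (hf : Integrable f ν) : Continuous (bilinFourier ψ B ν f) := by
  have : SecondCountableTopology V := secondCountable_of_finiteDimensional k V
  have hB := continuous_bilin B
  refine continuous_of_dominated (bound := fun y => ‖f y‖) (fun x => ?_) (fun x => ?_) hf.norm ?_
  · exact (integrable_mul_char hψ hf (hB.comp (by fun_prop : Continuous fun y => (y, x))).measurable).1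
  · exact Eventually.of_forall fun y => by simp
  · refine Eventually.of_forall fun y => continuous_const.mul ?_
    exact (continuous_char hψ).comp (hB.comp (by fun_prop : Continuous fun x => (y, x)))

lemma continuous_fourierQuad [CharZero k] (hψ : Continuous ψ) (q : QuadraticForm k V) {f : V → ℂ}
    (hf : Integrable f ν) : Continuous (fourierQuad ψ q ν f) := by
  have hq := continuous_quadraticForm q
  refine continuous_of_dominated (bound := fun y => ‖f y‖) (fun x => ?_) (fun x => ?_) hf.norm ?_
  · exact (integrable_mul_char hψ hf (by fun_prop : Continuous fun y => x * q y).measurable).1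
  · exact Eventually.of_forall fun y => by simp
  · refine Eventually.of_forall fun y => continuous_const.mul ?_
    exact (continuous_char hψ).comp (by fun_prop)

variable [ν.IsAddHaarMeasure]

/-- Inserting the inversion formula for f(Y + Z) and integrating in Y first leaves g(ξ) times the
conjugate of the transform of f at ξ - S. Z survives only in a phase, so the bound depends on S
alone; it is applied with S = tZ. -/
lemma enorm_autocorrelation_le (hψ : Continuous ψ) (B : LinearMap.BilinForm k V)
    (hB : ∀ x y, B x y = B y x) {f g : V → ℂ} (hf : Integrable f ν) (hg : Integrable g ν)
    (hfg : ∀ x, f x = ∫ ξ, g ξ * (ψ (-B ξ x) : ℂ) ∂ν) (Z S : V) :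
    ‖∫ Y, f (Y + Z) * conj (f Y) * (ψ (B Y S) : ℂ) ∂ν‖ₑ ≤
      ∫⁻ ξ, ‖g ξ‖ₑ * ‖bilinFourier ψ B ν f (ξ - S)‖ₑ ∂ν := by
  have : SecondCountableTopology V := secondCountable_of_finiteDimensional k V
  have : LocallyCompactSpace V := locallyCompact_of_finiteDimensional k V
  have hBc := continuous_bilin B
  have hprod : Integrable (fun p : V × V => conj (f p.1) * g p.2 *
      (ψ (B p.1 S - B p.2 (p.1 + Z)) : ℂ)) (ν.prod ν) := by
    have h1 : Integrable (fun Y => conj (f Y)) ν :=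
      (Complex.conjLIE.toContinuousLinearEquiv.toContinuousLinearMap).integrable_comp hf
    refine integrable_mul_char hψ (h1.mul_prod hg) (Continuous.measurable ?_)
    exact (hBc.comp (by fun_prop : Continuous fun p : V × V => (p.1, S))).sub
      (hBc.comp (by fun_prop : Continuous fun p : V × V => (p.2, p.1 + Z)))
  have h1 : ∫ Y, f (Y + Z) * conj (f Y) * (ψ (B Y S) : ℂ) ∂ν =
      ∫ Y, ∫ ξ, conj (f Y) * g ξ * (ψ (B Y S - B ξ (Y + Z)) : ℂ) ∂ν ∂ν := by
    refine integral_congr_ae (Eventually.of_forall fun Y => ?_)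
    simp only
    rw [hfg (Y + Z), mul_assoc, ← integral_mul_const]
    refine integral_congr_ae (Eventually.of_forall fun ξ => ?_)
    simp only
    rw [sub_eq_add_neg, char_add]
    ring
  rw [h1, integral_integral_swap hprod]
  refine (enorm_integral_le_lintegral_enorm _).trans (le_of_eq (lintegral_congr fun ξ => ?_))
  have h2 : ∫ Y, conj (f Y) * g ξ * (ψ (B Y S - B ξ (Y + Z)) : ℂ) ∂ν =
      (g ξ * (ψ (-B ξ Z) : ℂ)) * conj (bilinFourier ψ B ν f (ξ - S)) := by
    rw [bilinFourier, ← integral_conj, ← integral_const_mul]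
    refine integral_congr_ae (Eventually.of_forall fun Y => ?_)
    simp only [map_mul, conj_char]
    have : B Y S - B ξ (Y + Z) = -B ξ Z + -(B Y (ξ - S)) := by
      rw [map_add, map_sub, hB ξ Y]; ring
    rw [this, char_add]
    ring
  rw [h2]
  simp [enorm_mul]

/-- Decay of the transform along a quadratic form, from integrability of the linear Fourier
transform. -/
theorem enorm_fourierQuad_sq_le [CharZero k] (hψ : Continuous ψ) (q : QuadraticForm k V)
    (hν : IsSelfDual ψ (QuadraticMap.polarBilin q) ν) {φ : V → ℂ} (hφc : Continuous φ)
    (hφ : Integrable φ ν) (hφ' : Integrable (bilinFourier ψ (QuadraticMap.polarBilin q) ν φ) ν)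
    {t : k} (ht : t ≠ 0) :
    ‖fourierQuad ψ q ν φ t‖ₑ ^ 2 ≤ ENNReal.ofReal (modulus t ^ Module.finrank k V)⁻¹ *
      (∫⁻ X, ‖bilinFourier ψ (QuadraticMap.polarBilin q) ν φ X‖ₑ ∂ν) ^ 2 := by
  have : SecondCountableTopology V := secondCountable_of_finiteDimensional k V
  have : LocallyCompactSpace V := locallyCompact_of_finiteDimensional k V
  set B := QuadraticMap.polarBilin q with hBdef
  have hBs : ∀ x y, B x y = B y x := fun x y => by
    simp [hBdef, QuadraticMap.polar_comm]
  set g := bilinFourier ψ B ν φ with hg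
  have hgc : Continuous g := continuous_bilinFourier hψ B hφ
  have hqc := continuous_quadraticForm q
  have hBc := continuous_bilin B
  have hinv : ∀ x, φ x = ∫ ξ, g ξ * (ψ (-B ξ x) : ℂ) ∂ν := fun x => by
    have := hν.2 φ hφc hφ hφ' (-x)
    rw [neg_neg] at this
    rw [← this]
    simp [bilinFourier, hg]
  have hconj : Integrable (fun Y => conj (φ Y)) ν :=
    (Complex.conjLIE.toContinuousLinearEquiv.toContinuousLinearMap).integrable_comp hφ
  have hprod : Integrable (fun p : V × V => conj (φ p.1) * φ (p.1 + p.2) *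
      (ψ (t * q (p.1 + p.2) - t * q p.1) : ℂ)) (ν.prod ν) := by
    refine integrable_mul_char hψ ?_ (Continuous.measurable (by fun_prop))
    exact (measurePreserving_prod_add ν ν).integrable_comp_of_integrable (hconj.mul_prod hφ)
  -- Translating one variable by the other uses q(Y + Z) - q(Y) = q(Z) + B(Y, Z): the quadratic
  -- phase in Y cancels and only a linear character is left.
  have key : fourierQuad ψ q ν φ t * conj (fourierQuad ψ q ν φ t) =
      ∫ Z, (ψ (t * q Z) : ℂ) * ∫ Y, φ (Y + Z) * conj (φ Y) * (ψ (B Y (t • Z)) : ℂ) ∂ν ∂ν := by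
    calc fourierQuad ψ q ν φ t * conj (fourierQuad ψ q ν φ t)
        = ∫ Y, ∫ Z, conj (φ Y) * φ (Y + Z) * (ψ (t * q (Y + Z) - t * q Y) : ℂ) ∂ν ∂ν := by
          rw [fourierQuad, ← integral_conj, ← integral_const_mul]
          refine integral_congr_ae (Eventually.of_forall fun Y => ?_)
          simp only
          rw [← integral_mul_const, ← integral_add_left_eq_self
            (fun X => φ X * (ψ (t * q X) : ℂ) * conj (φ Y * (ψ (t * q Y) : ℂ))) Y]
          refine integral_congr_ae (Eventually.of_forall fun Z => ?_)
          simp only [map_mul, conj_char]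
          rw [sub_eq_add_neg, char_add]
          ring
      _ = ∫ Z, ∫ Y, conj (φ Y) * φ (Y + Z) * (ψ (t * q (Y + Z) - t * q Y) : ℂ) ∂ν ∂ν :=
          integral_integral_swap hprod
      _ = _ := by
          refine integral_congr_ae (Eventually.of_forall fun Z => ?_)
          simp only
          rw [← integral_const_mul]
          refine integral_congr_ae (Eventually.of_forall fun Y => ?_)
          have : t * q (Y + Z) - t * q Y = t * q Z + B Y (t • Z) := by
            simp only [hBdef, map_smul, QuadraticMap.polarBilin_apply_apply, QuadraticMap.polar,
              smul_eq_mul]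
            ring
          simp only
          rw [this, char_add]
          ring
  calc ‖fourierQuad ψ q ν φ t‖ₑ ^ 2
      = ‖fourierQuad ψ q ν φ t * conj (fourierQuad ψ q ν φ t)‖ₑ := by
        rw [enorm_mul, sq]
        congr 1
        simp [enorm_eq_nnnorm]
    _ ≤ ∫⁻ Z, ∫⁻ ξ, ‖g ξ‖ₑ * ‖g (ξ - t • Z)‖ₑ ∂ν ∂ν := by
        rw [key]
        refine (enorm_integral_le_lintegral_enorm _).trans (lintegral_mono fun Z => ?_)
        have := enorm_autocorrelation_le hψ B hBs hφ hφ' hinv Z (t • Z)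
        rwa [enorm_mul, enorm_char, one_mul]
    _ = ∫⁻ ξ, ∫⁻ Z, ‖g ξ‖ₑ * ‖g (ξ - t • Z)‖ₑ ∂ν ∂ν :=
        by
        refine lintegral_lintegral_swap (Measurable.aemeasurable ?_)
        have h1 : Measurable fun p : V × V => ‖g p.2‖ₑ :=
          (hgc.comp continuous_snd).enorm.measurable
        have h2 : Measurable fun p : V × V => ‖g (p.2 - t • p.1)‖ₑ :=
          Continuous.measurable (by fun_prop)
        exact h1.mul h2
    _ = ∫⁻ ξ, ‖g ξ‖ₑ * (ENNReal.ofReal (modulus t ^ Module.finrank k V)⁻¹ *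
          ∫⁻ X, ‖g X‖ₑ ∂ν) ∂ν := by
        -- The dilation Z ↦ tZ produces the decay factor |t|^{-n}; translation and reflection
        -- invariance do the rest.
        refine lintegral_congr fun ξ => ?_
        rw [lintegral_const_mul _ (Continuous.measurable (by fun_prop)),
          lintegral_comp_smul ν ht (fun Z => ‖g (ξ - Z)‖ₑ),
          lintegral_sub_left_eq_self (fun Z => ‖g Z‖ₑ) ξ]
    _ = _ := by
        rw [lintegral_mul_const _ hgc.enorm.measurable]
        ring

/-- The transform along a quadratic form of dimension at least two is square integrable. -/
theorem lintegral_fourierQuad_sq_lt_top [CharZero k] (hψ : Continuous ψ) (q : QuadraticForm k V)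
    (hV : 2 ≤ Module.finrank k V) (μ : Measure k) [μ.IsAddHaarMeasure]
    (hν : IsSelfDual ψ (QuadraticMap.polarBilin q) ν) {φ : V → ℂ} (hφc : Continuous φ)
    (hφ : Integrable φ ν) (hφ' : Integrable (bilinFourier ψ (QuadraticMap.polarBilin q) ν φ) ν) :
    ∫⁻ t, ‖fourierQuad ψ q ν φ t‖ₑ ^ 2 ∂μ < ∞ := by
  have hS : MeasurableSet {t : k | 1 < ‖t‖} := measurableSet_lt measurable_const measurable_norm
  rw [← lintegral_add_compl _ hS]
  refine ENNReal.add_lt_top.2 ⟨?_, ?_⟩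
  · set C := (∫⁻ X, ‖bilinFourier ψ (QuadraticMap.polarBilin q) ν φ X‖ₑ ∂ν) ^ 2 with hC
    have hCt : C ≠ ∞ := pow_ne_top hφ'.2.ne
    calc ∫⁻ t in {t : k | 1 < ‖t‖}, ‖fourierQuad ψ q ν φ t‖ₑ ^ 2 ∂μ
        ≤ ∫⁻ t in {t : k | 1 < ‖t‖}, ENNReal.ofReal (modulus t ^ 2)⁻¹ * C ∂μ := by
          refine setLIntegral_mono_ae' hS (Eventually.of_forall fun t ht => ?_)
          have ht1 : 1 < ‖t‖ := ht
          have ht0 : t ≠ 0 := norm_pos_iff.1 (zero_lt_one.trans ht1)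
          -- Since |t| ≥ 1 here and n ≥ 2, |t|^{-n} is at most |t|⁻². On the complementary ball the
          -- trivial bound by ‖φ‖₁ suffices.
          refine (enorm_fourierQuad_sq_le hψ q hν hφc hφ hφ' ht0).trans ?_
          have := one_le_modulus ht1.le
          have := modulus_pos ht0
          gcongr
      _ < ∞ := by
          rw [lintegral_mul_const' _ _ hCt]
          exact ENNReal.mul_lt_top (lintegral_inv_modulus_sq_lt_top μ) hCt.lt_top
  · have hsub : {t : k | 1 < ‖t‖}ᶜ ⊆ Metric.closedBall (0 : k) 1 := fun t ht => by
      simpa using ht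
    calc ∫⁻ t in {t : k | 1 < ‖t‖}ᶜ, ‖fourierQuad ψ q ν φ t‖ₑ ^ 2 ∂μ
        ≤ ∫⁻ _ in {t : k | 1 < ‖t‖}ᶜ, (∫⁻ y, ‖φ y‖ₑ ∂ν) ^ 2 ∂μ :=
          lintegral_mono fun t => by gcongr; exact enorm_fourierQuad_le q φ t
      _ < ∞ := by
          rw [setLIntegral_const]
          exact ENNReal.mul_lt_top (pow_lt_top hφ.2)
            ((measure_mono hsub).trans_lt (isCompact_closedBall _ _).measure_lt_top)

end Decay

/-! ### Summation kernels, regularized Fourier inversion, and an L² bound on k. -/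

section Summation

variable {k : Type*} [NontriviallyNormedField k] [MeasurableSpace k] {ψ : AddChar k Circle} {μ : Measure k}

/-- The Fourier transform on `k` for the pairing `ψ(xy)`. -/
noncomputable def fourierField (ψ : AddChar k Circle) (μ : Measure k) (G : k → ℂ) : k → ℂ :=
  bilinFourier ψ (LinearMap.mul k k) μ G

lemma fourierField_apply (G : k → ℂ) (t : k) :
    fourierField ψ μ G t = ∫ y, G y * (ψ (y * t) : ℂ) ∂μ := rfl

/-- A nonnegative integrable continuous function with integrable Fourier transform,
equal to `1` at `0`. -/
structure IsSummationKernel (ψ : AddChar k Circle) (μ : Measure k) (K : k → ℂ) : Prop where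
  continuous : Continuous K
  norm_le : ∀ x, ‖K x‖ ≤ 1
  ofReal_norm : ∀ x, ((‖K x‖ : ℝ) : ℂ) = K x
  apply_zero : K 0 = 1
  integrable : Integrable K μ
  integrable_fourier : Integrable (fourierField ψ μ K) μ

variable {K : k → ℂ}

lemma integral_fourierField_kernel (hSD : IsSelfDual ψ (LinearMap.mul k k) μ)
    (hK : IsSummationKernel ψ μ K) : ∫ z, fourierField ψ μ K z ∂μ = 1 := by
  have h := hSD.2 K hK.continuous hK.integrable hK.integrable_fourier 0
  rw [neg_zero, hK.apply_zero] at h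
  rw [← h]
  simp [bilinFourier, fourierField]

lemma tendsto_kernel (hK : IsSummationKernel ψ μ K) (t : k) :
    Tendsto (fun l : k => K (l * t)) (𝓝[≠] 0) (𝓝 1) := by
  have hc := hK.continuous
  have h : Tendsto (fun l : k => K (l * t)) (𝓝 0) (𝓝 (K (0 * t))) :=
    Continuous.tendsto (by fun_prop) 0
  rw [zero_mul, hK.apply_zero] at h
  exact h.mono_left nhdsWithin_le_nhds

variable [LocallyCompactSpace k] [BorelSpace k]

lemma continuous_fourierField (hψ : Continuous ψ) {G : k → ℂ} (hG : Integrable G μ) :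
    Continuous (fourierField ψ μ G) :=
  continuous_bilinFourier hψ _ hG

lemma integrable_mul_fourierField (hψ : Continuous ψ) {G h : k → ℂ} (hG : Integrable G μ)
    (hh : Integrable h μ) : Integrable (fun t => fourierField ψ μ G t * h t) μ := by
  refine hh.bdd_mul (c := ∫ y, ‖G y‖ ∂μ)
    (continuous_fourierField hψ hG).aestronglyMeasurable (Eventually.of_forall fun t => ?_)
  refine (norm_integral_le_integral_norm _).trans (le_of_eq ?_)
  simp

variable [μ.IsAddHaarMeasure] {X : Type*} [MeasurableSpace X] {ν : Measure X}

/-- The damping K(lt) makes Fubini legitimate. The result averages G around u against K̂ at scale l,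
an approximate identity as l → 0. -/
lemma integral_fourierField_mul_kernel (hψ : Continuous ψ) (hK : IsSummationKernel ψ μ K)
    {G : k → ℂ} (hG : Integrable G μ) {l : k} (hl : l ≠ 0) (u : k) :
    ∫ t, fourierField ψ μ G t * K (l * t) * (ψ (-(t * u)) : ℂ) ∂μ =
      ∫ z, G (u + l * z) * fourierField ψ μ K z ∂μ := by
  have hKl : Integrable (fun t => K (l * t)) μ := integrable_comp_mul_left μ hl hK.integrable
  have hprod : Integrable (fun p : k × k => K (l * p.1) * G p.2 *
      (ψ (p.2 * p.1 - p.1 * u) : ℂ)) (μ.prod μ) :=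
    integrable_mul_char hψ (hKl.mul_prod hG) (Continuous.measurable (by fun_prop))
  calc ∫ t, fourierField ψ μ G t * K (l * t) * (ψ (-(t * u)) : ℂ) ∂μ
      = ∫ t, ∫ y, K (l * t) * G y * (ψ (y * t - t * u) : ℂ) ∂μ ∂μ := by
        refine integral_congr_ae (Eventually.of_forall fun t => ?_)
        simp only
        rw [fourierField_apply, mul_assoc, ← integral_mul_const]
        refine integral_congr_ae (Eventually.of_forall fun y => ?_)
        simp only
        rw [sub_eq_add_neg, char_add]
        ring
    _ = ∫ y, ∫ t, K (l * t) * G y * (ψ (y * t - t * u) : ℂ) ∂μ ∂μ := integral_integral_swap hprod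
    _ = ∫ y, ((modulus l)⁻¹ : ℝ) * (G y * fourierField ψ μ K (l⁻¹ * (y - u))) ∂μ := by
        refine integral_congr_ae (Eventually.of_forall fun y => ?_)
        have h := integral_comp_mul_left μ hl
          (fun t => K t * (ψ (t * (l⁻¹ * (y - u))) : ℂ))
        simp only
        rw [mul_left_comm, fourierField_apply, ← h, ← integral_const_mul]
        refine integral_congr_ae (Eventually.of_forall fun t => ?_)
        have : l * t * (l⁻¹ * (y - u)) = y * t - t * u := by field_simp
        simp only
        rw [this]
        ring
    _ = ∫ z, G (u + l * z) * fourierField ψ μ K z ∂μ := by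
        rw [integral_const_mul, ← integral_add_left_eq_self _ u, ← integral_comp_mul_left μ hl]
        refine integral_congr_ae (Eventually.of_forall fun z => ?_)
        simp only
        rw [add_sub_cancel_left, inv_mul_cancel_left₀ hl]

/-- The space X and the map p are kept general because two cases are needed: p = q on V for the
transfer identity, and p = id on k for the L² bound. -/
lemma integral_fourierField_mul_integral_mul_kernel [SFinite ν] (hψ : Continuous ψ)
    (hK : IsSummationKernel ψ μ K) {G : k → ℂ} (hG : Integrable G μ) {φ : X → ℂ}
    (hφ : Integrable φ ν) {p : X → k} (hp : Measurable p) {l : k} (hl : l ≠ 0) :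
    ∫ t, fourierField ψ μ G t * (∫ x, φ x * (ψ (-t * p x) : ℂ) ∂ν) * K (l * t) ∂μ =
      ∫ x, φ x * ∫ z, G (p x + l * z) * fourierField ψ μ K z ∂μ ∂ν := by
  have hKl : Integrable (fun t => K (l * t)) μ := integrable_comp_mul_left μ hl hK.integrable
  have hprod : Integrable (fun y : k × X => fourierField ψ μ G y.1 * K (l * y.1) * φ y.2 *
      (ψ (-(y.1 * p y.2)) : ℂ)) (μ.prod ν) :=
    integrable_mul_char hψ ((integrable_mul_fourierField hψ hG hKl).mul_prod hφ) (by fun_prop)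
  calc ∫ t, fourierField ψ μ G t * (∫ x, φ x * (ψ (-t * p x) : ℂ) ∂ν) * K (l * t) ∂μ
      = ∫ t, ∫ x, fourierField ψ μ G t * K (l * t) * φ x * (ψ (-(t * p x)) : ℂ) ∂ν ∂μ := by
        refine integral_congr_ae (Eventually.of_forall fun t => ?_)
        simp only
        rw [mul_right_comm, ← integral_const_mul]
        refine integral_congr_ae (Eventually.of_forall fun x => ?_)
        simp only [neg_mul]
        ring
    _ = ∫ x, ∫ t, fourierField ψ μ G t * K (l * t) * φ x * (ψ (-(t * p x)) : ℂ) ∂μ ∂ν :=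
        integral_integral_swap hprod
    _ = _ := by
        refine integral_congr_ae (Eventually.of_forall fun x => ?_)
        simp only
        rw [← integral_fourierField_mul_kernel hψ hK hG hl, ← integral_const_mul]
        refine integral_congr_ae (Eventually.of_forall fun t => ?_)
        simp only
        ring

/-- Transfer of a bounded continuous integrable function through the Fourier transform. -/
theorem integral_fourierField_mul_integral [SFinite ν] (hψ : Continuous ψ)
    (hSD : IsSelfDual ψ (LinearMap.mul k k) μ)
    (hK : IsSummationKernel ψ μ K) {g : k → ℂ} (hgc : Continuous g) (hg : Integrable g μ)
    {C : ℝ} (hC : ∀ x, ‖g x‖ ≤ C) {φ : X → ℂ} (hφ : Integrable φ ν) {p : X → k}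
    (hp : Measurable p)
    (hprod : Integrable (fun t => fourierField ψ μ g t * ∫ x, φ x * (ψ (-t * p x) : ℂ) ∂ν) μ) :
    ∫ t, fourierField ψ μ g t * (∫ x, φ x * (ψ (-t * p x) : ℂ) ∂ν) ∂μ =
      ∫ x, φ x * g (p x) ∂ν := by
  have hKc := hK.continuous
  have hC0 : 0 ≤ C := (norm_nonneg _).trans (hC 0)
  have hKhc : Continuous (fourierField ψ μ K) := continuous_fourierField hψ hK.integrable
  have h1 : Tendsto (fun l : k => ∫ t, fourierField ψ μ g t *
      (∫ x, φ x * (ψ (-t * p x) : ℂ) ∂ν) * K (l * t) ∂μ) (𝓝[≠] 0)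
      (𝓝 (∫ t, fourierField ψ μ g t * (∫ x, φ x * (ψ (-t * p x) : ℂ) ∂ν) ∂μ)) := by
    refine tendsto_integral_filter_of_dominated_convergence
      (fun t => ‖fourierField ψ μ g t * (∫ x, φ x * (ψ (-t * p x) : ℂ) ∂ν)‖)
      (Eventually.of_forall fun l => hprod.1.mul
        (Continuous.aestronglyMeasurable (by fun_prop)))
      (Eventually.of_forall fun l => Eventually.of_forall fun t => ?_) hprod.norm
      (Eventually.of_forall fun t => ?_)
    · rw [norm_mul]
      exact mul_le_of_le_one_right (norm_nonneg _) (hK.norm_le _)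
    · simpa using (tendsto_kernel hK t).const_mul
        (fourierField ψ μ g t * (∫ x, φ x * (ψ (-t * p x) : ℂ) ∂ν))
  -- K̂ has total integral K(0) = 1, so the averages tend to g(u); boundedness of g gives the
  -- domination.
  have h2 : ∀ u : k, Tendsto (fun l : k => ∫ z, g (u + l * z) * fourierField ψ μ K z ∂μ)
      (𝓝[≠] 0) (𝓝 (g u)) := by
    intro u
    have : g u = ∫ z, g u * fourierField ψ μ K z ∂μ := by
      rw [integral_const_mul, integral_fourierField_kernel hSD hK, mul_one]
    rw [this]
    refine tendsto_integral_filter_of_dominated_convergence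
      (fun z => C * ‖fourierField ψ μ K z‖)
      (Eventually.of_forall fun l => Continuous.aestronglyMeasurable (by fun_prop))
      (Eventually.of_forall fun l => Eventually.of_forall fun z => ?_)
      (hK.integrable_fourier.norm.const_mul C) (Eventually.of_forall fun z => ?_)
    · rw [norm_mul]
      gcongr
      exact hC _
    · have : Tendsto (fun l : k => g (u + l * z) * fourierField ψ μ K z) (𝓝 0)
          (𝓝 (g (u + 0 * z) * fourierField ψ μ K z)) := Continuous.tendsto (by fun_prop) 0
      rw [zero_mul, add_zero] at this
      exact this.mono_left nhdsWithin_le_nhds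
  have h3 : Tendsto (fun l : k => ∫ x, φ x * ∫ z, g (p x + l * z) * fourierField ψ μ K z ∂μ ∂ν)
      (𝓝[≠] 0) (𝓝 (∫ x, φ x * g (p x) ∂ν)) := by
    refine tendsto_integral_filter_of_dominated_convergence
      (fun x => ‖φ x‖ * (C * ∫ z, ‖fourierField ψ μ K z‖ ∂μ))
      (Eventually.of_forall fun l => hφ.1.mul ?_)
      (Eventually.of_forall fun l => Eventually.of_forall fun x => ?_)
      (hφ.norm.mul_const _) (Eventually.of_forall fun x => (h2 (p x)).const_mul _)
    · have hm : StronglyMeasurable fun y : X × k => g (p y.1 + l * y.2) * fourierField ψ μ K y.2 :=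
        ((hgc.measurable.comp (by fun_prop)).mul
          (hKhc.measurable.comp measurable_snd)).stronglyMeasurable
      exact hm.integral_prod_right.aestronglyMeasurable
    · rw [norm_mul]
      gcongr
      rw [← integral_const_mul]
      refine norm_integral_le_of_norm_le (hK.integrable_fourier.norm.const_mul C)
        (Eventually.of_forall fun z => ?_)
      rw [norm_mul]
      gcongr
      exact hC _
  refine tendsto_nhds_unique h1 (h3.congr' ?_)
  filter_upwards [self_mem_nhdsWithin] with l (hl : l ≠ 0)
  exact (integral_fourierField_mul_integral_mul_kernel hψ hK hg hφ hp hl).symm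

/-- Taking p = id and φ = conj G makes the regularized pairing into ∫ |Ĝ|² K(lt), and the averaged
side is bounded uniformly in l. -/
lemma lintegral_fourierField_sq_mul_kernel_le (hψ : Continuous ψ)
    (hK : IsSummationKernel ψ μ K) {G : k → ℂ} (hGm : Measurable G) (hG : Integrable G μ) {l : k}
    (hl : l ≠ 0) :
    ‖∫ t, fourierField ψ μ G t * conj (fourierField ψ μ G t) * K (l * t) ∂μ‖ₑ ≤
      2 * (∫⁻ z, ‖fourierField ψ μ K z‖ₑ ∂μ) * ∫⁻ x, ‖G x‖ₑ ^ 2 ∂μ := by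
  have hKhc : Continuous (fourierField ψ μ K) := continuous_fourierField hψ hK.integrable
  have hconj : Integrable (fun Y => conj (G Y)) μ :=
    (Complex.conjLIE.toContinuousLinearEquiv.toContinuousLinearMap).integrable_comp hG
  have h := integral_fourierField_mul_integral_mul_kernel hψ hK hG hconj measurable_id hl
  have h1 : ∀ t, conj (fourierField ψ μ G t) = ∫ x, conj (G x) * (ψ (-t * id x) : ℂ) ∂μ := by
    intro t
    rw [fourierField_apply, ← integral_conj]
    refine integral_congr_ae (Eventually.of_forall fun x => ?_)
    simp only [map_mul, conj_char, id]
    congr 3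
    ring
  simp_rw [h1, h]
  -- This crude inequality is the source of the constant 2; only boundedness on L² is needed, not
  -- the Plancherel identity.
  have hmul : ∀ a b : ℝ≥0∞, a * b ≤ a ^ 2 + b ^ 2 := by
    intro a b
    rcases le_total a b with hab | hab
    · calc a * b ≤ b * b := by gcongr
        _ ≤ _ := by rw [← sq]; exact le_add_self
    · calc a * b ≤ a * a := by gcongr
        _ ≤ _ := by rw [← sq]; exact le_self_add
  calc ‖∫ x, conj (G x) * ∫ z, G (id x + l * z) * fourierField ψ μ K z ∂μ ∂μ‖ₑ
      ≤ ∫⁻ x, ‖G x‖ₑ * ∫⁻ z, ‖G (x + l * z)‖ₑ * ‖fourierField ψ μ K z‖ₑ ∂μ ∂μ := by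
        refine (enorm_integral_le_lintegral_enorm _).trans (lintegral_mono fun x => ?_)
        rw [enorm_mul]
        gcongr
        · simp [enorm_eq_nnnorm]
        · refine (enorm_integral_le_lintegral_enorm _).trans (le_of_eq ?_)
          simp [enorm_mul]
    _ = ∫⁻ x, ∫⁻ z, ‖fourierField ψ μ K z‖ₑ * (‖G x‖ₑ * ‖G (x + l * z)‖ₑ) ∂μ ∂μ := by
        refine lintegral_congr fun x => ?_
        rw [← lintegral_const_mul _ (by fun_prop)]
        refine lintegral_congr fun z => ?_
        ring
    _ = ∫⁻ z, ∫⁻ x, ‖fourierField ψ μ K z‖ₑ * (‖G x‖ₑ * ‖G (x + l * z)‖ₑ) ∂μ ∂μ :=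
        lintegral_lintegral_swap (by fun_prop)
    _ ≤ ∫⁻ z, ‖fourierField ψ μ K z‖ₑ * (2 * ∫⁻ x, ‖G x‖ₑ ^ 2 ∂μ) ∂μ := by
        refine lintegral_mono fun z => ?_
        rw [lintegral_const_mul _ (by fun_prop)]
        gcongr
        refine (lintegral_mono fun x => hmul _ _).trans ?_
        rw [lintegral_add_left (by fun_prop),
          lintegral_add_right_eq_self (fun x => ‖G x‖ₑ ^ 2) (l * z), two_mul]
    _ = _ := by
        rw [lintegral_mul_const _ (by fun_prop)]
        ring

/-- The Fourier transform is bounded in the square norm on integrable functions. -/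
theorem lintegral_fourierField_sq_le (hψ : Continuous ψ) (hK : IsSummationKernel ψ μ K)
    {G : k → ℂ} (hG : Integrable G μ) :
    ∫⁻ t, ‖fourierField ψ μ G t‖ₑ ^ 2 ∂μ ≤
      2 * (∫⁻ z, ‖fourierField ψ μ K z‖ₑ ∂μ) * ∫⁻ x, ‖G x‖ₑ ^ 2 ∂μ := by
  wlog hGm : Measurable G generalizing G
  · have hae : G =ᵐ[μ] hG.1.mk G := hG.1.ae_eq_mk
    have h := this (hG.congr hae) hG.1.stronglyMeasurable_mk.measurable
    have h1 : fourierField ψ μ (hG.1.mk G) = fourierField ψ μ G := by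
      ext t
      rw [fourierField_apply, fourierField_apply]
      refine integral_congr_ae ?_
      filter_upwards [hae] with x hx
      rw [hx]
    have h2 : ∫⁻ x, ‖hG.1.mk G x‖ₑ ^ 2 ∂μ = ∫⁻ x, ‖G x‖ₑ ^ 2 ∂μ := by
      refine lintegral_congr_ae ?_
      filter_upwards [hae] with x hx
      rw [hx]
    rwa [h1, h2] at h
  have hGhc : Continuous (fourierField ψ μ G) := continuous_fourierField hψ hG
  have hKc := hK.continuous
  have hkey : ∀ l : k, l ≠ 0 →
      ∫⁻ t, ‖fourierField ψ μ G t‖ₑ ^ 2 * ‖K (l * t)‖ₑ ∂μ ≤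
        2 * (∫⁻ z, ‖fourierField ψ μ K z‖ₑ ∂μ) * ∫⁻ x, ‖G x‖ₑ ^ 2 ∂μ := by
    intro l hl
    refine le_trans (le_of_eq ?_) (lintegral_fourierField_sq_mul_kernel_le hψ hK hGm hG hl)
    have hKl : Integrable (fun t => K (l * t)) μ := integrable_comp_mul_left μ hl hK.integrable
    have hI : Integrable (fun t => ‖fourierField ψ μ G t‖ ^ 2 * ‖K (l * t)‖) μ := by
      refine (integrable_mul_fourierField hψ hG (integrable_mul_fourierField hψ hG hKl)).norm.congr
        (Eventually.of_forall fun t => ?_)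
      simp only [norm_mul]
      ring
    have h1 : ∫ t, fourierField ψ μ G t * conj (fourierField ψ μ G t) * K (l * t) ∂μ =
        ((∫ t, ‖fourierField ψ μ G t‖ ^ 2 * ‖K (l * t)‖ ∂μ : ℝ) : ℂ) := by
      rw [← integral_complex_ofReal]
      refine integral_congr_ae (Eventually.of_forall fun t => ?_)
      simp only [Complex.mul_conj, Complex.normSq_eq_norm_sq]
      push_cast
      rw [hK.ofReal_norm]
    have h2 : 0 ≤ ∫ t, ‖fourierField ψ μ G t‖ ^ 2 * ‖K (l * t)‖ ∂μ :=
      integral_nonneg fun t => by positivity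
    rw [h1, ← ofReal_norm, Complex.norm_real, Real.norm_of_nonneg h2,
      ofReal_integral_eq_lintegral_ofReal hI (Eventually.of_forall fun t => by positivity)]
    refine lintegral_congr fun t => ?_
    rw [ENNReal.ofReal_mul (by positivity), ENNReal.ofReal_pow (norm_nonneg _), ofReal_norm,
      ofReal_norm]
  -- Fatou's lemma along a sequence l → 0 removes the kernel, since K(lt) → 1.
  obtain ⟨l, hl⟩ := exists_seq_tendsto (𝓝[≠] (0 : k))
  have hl0 : ∀ᶠ n in atTop, l n ≠ 0 := hl.eventually self_mem_nhdsWithin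
  calc ∫⁻ t, ‖fourierField ψ μ G t‖ₑ ^ 2 ∂μ
      = ∫⁻ t, liminf (fun n => ‖fourierField ψ μ G t‖ₑ ^ 2 * ‖K (l n * t)‖ₑ) atTop ∂μ := by
        refine lintegral_congr fun t => ?_
        have h1 : Tendsto (fun n => ‖K (l n * t)‖ₑ) atTop (𝓝 1) := by
          simpa using ((tendsto_kernel hK t).comp hl).enorm
        have h2 := ENNReal.Tendsto.const_mul (a := ‖fourierField ψ μ G t‖ₑ ^ 2) h1
          (Or.inl one_ne_zero)
        rw [mul_one] at h2
        exact h2.liminf_eq.symm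
    _ ≤ liminf (fun n => ∫⁻ t, ‖fourierField ψ μ G t‖ₑ ^ 2 * ‖K (l n * t)‖ₑ ∂μ) atTop :=
        lintegral_liminf_le fun n => Measurable.mul (hGhc.enorm.measurable.pow_const 2)
          (Continuous.measurable (by fun_prop))
    _ ≤ _ := by
        refine liminf_le_of_le (by isBoundedDefault) fun b hb => ?_
        obtain ⟨n, hn, hn0⟩ := (hb.and hl0).exists
        exact hn.trans (hkey (l n) hn0)

end Summation

/-! ### Extending an L² bound from compactly supported continuous functions. -/

section MeasureBound

lemma eLpNorm_two_eq {α : Type*} [MeasurableSpace α] (m : Measure α) (f : α → ℂ) :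
    eLpNorm f 2 m = (∫⁻ x, ‖f x‖ₑ ^ 2 ∂m) ^ (1 / 2 : ℝ) := by
  rw [eLpNorm_eq_lintegral_rpow_enorm_toReal two_ne_zero ENNReal.ofNat_ne_top]
  simp

variable {α : Type*} [MetricSpace α] [ProperSpace α] [MeasurableSpace α] [BorelSpace α]
  {μ m : Measure α} [IsLocallyFiniteMeasure μ] [IsFiniteMeasure m] {C : ℝ≥0∞}

/-- Testing on Urysohn functions below an open U gives m(U) ≤ C μ(U)^{1/2}; outer regularity of μ
then covers null sets. -/
lemma absolutelyContinuous_of_lintegral_le (hC : C ≠ ∞)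
    (h : ∀ g : α → ℂ, Continuous g → HasCompactSupport g →
      ∫⁻ x, ‖g x‖ₑ ∂m ≤ C * eLpNorm g 2 μ) : m ≪ μ := by
  refine Measure.AbsolutelyContinuous.mk fun s hs hs0 => ?_
  have hopen : ∀ U : Set α, IsOpen U → m U ≤ C * μ U ^ (1 / 2 : ℝ) := by
    intro U hU
    rw [hU.measure_eq_iSup_isCompact]
    refine iSup₂_le fun T hT => iSup_le fun hTc => ?_
    obtain ⟨f, hf1, hf0, hfc, hf01⟩ := exists_continuous_one_zero_of_isCompact hTc
      hU.isClosed_compl (Set.disjoint_compl_right_iff_subset.2 hT)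
    have hg := h (fun x => (f x : ℂ)) (by fun_prop)
      (hfc.comp_left (g := fun r : ℝ => (r : ℂ)) Complex.ofReal_zero)
    calc m T = ∫⁻ x, T.indicator 1 x ∂m := (lintegral_indicator_one hTc.measurableSet).symm
      _ ≤ ∫⁻ x, ‖(f x : ℂ)‖ₑ ∂m := by
          refine lintegral_mono fun x => ?_
          by_cases hx : x ∈ T
          · simp [hx, hf1 hx]
          · simp [hx]
      _ ≤ C * eLpNorm (fun x => (f x : ℂ)) 2 μ := hg
      _ ≤ C * μ U ^ (1 / 2 : ℝ) := by
          rw [eLpNorm_two_eq]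
          gcongr
          rw [← lintegral_indicator_one hU.measurableSet]
          refine lintegral_mono fun x => ?_
          by_cases hx : x ∈ U
          · rw [Set.indicator_of_mem hx, Pi.one_apply]
            refine pow_le_one' ?_ 2
            rw [← ofReal_norm, Complex.norm_real, Real.norm_of_nonneg (hf01 x).1]
            exact ENNReal.ofReal_le_one.2 (hf01 x).2
          · simp [hf0 (show x ∈ Uᶜ from hx)]
  refine le_antisymm (_root_.le_of_forall_pos_le_add fun ε hε => ?_) zero_le
  rw [zero_add]
  have ht : Tendsto (fun r : ℝ≥0∞ => C * r ^ (1 / 2 : ℝ)) (𝓝 0) (𝓝 0) := by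
    have := ENNReal.Tendsto.const_mul (a := C)
      (ENNReal.continuous_rpow_const (y := (1 / 2 : ℝ)).tendsto 0) (Or.inr hC)
    simpa using this
  obtain ⟨r, hr, hr0⟩ := (((ht.mono_left nhdsWithin_le_nhds).eventually_le_const hε).and
    (self_mem_nhdsWithin : Set.Ioi (0 : ℝ≥0∞) ∈ 𝓝[>] 0)).exists
  obtain ⟨U, hsU, hU, hUr⟩ := s.exists_isOpen_lt_of_lt r (μ := μ) (by rw [hs0]; exact hr0)
  calc m s ≤ m U := measure_mono hsU
    _ ≤ C * μ U ^ (1 / 2 : ℝ) := hopen U hU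
    _ ≤ C * r ^ (1 / 2 : ℝ) := by gcongr
    _ ≤ ε := hr

/-- A bound of an integral by an `L²` norm extends from compactly supported continuous functions. -/
lemma lintegral_le_of_forall_compactSupport (hC : C ≠ ∞)
    (h : ∀ g : α → ℂ, Continuous g → HasCompactSupport g →
      ∫⁻ x, ‖g x‖ₑ ∂m ≤ C * eLpNorm g 2 μ) {H : α → ℂ} (hH : MemLp H 2 μ) :
    ∫⁻ x, ‖H x‖ₑ ∂m ≤ C * eLpNorm H 2 μ := by
  -- Approximation in L²(μ) gives a subsequence converging μ-almost everywhere; absolute continuity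
  -- makes this hold m-almost everywhere, so that Fatou applies under m.
  have hac := absolutelyContinuous_of_lintegral_le hC h
  have hε : ∀ n : ℕ, ((n : ℝ≥0∞) + 1)⁻¹ ≠ 0 := fun n =>
    ENNReal.inv_ne_zero.2 (ENNReal.add_ne_top.2 ⟨ENNReal.natCast_ne_top n, one_ne_top⟩)
  choose g hgs hgn hgc hgm using fun n : ℕ =>
    hH.exists_hasCompactSupport_eLpNorm_sub_le ENNReal.ofNat_ne_top (hε n)
  have hε0 : Tendsto (fun n : ℕ => ((n : ℝ≥0∞) + 1)⁻¹) atTop (𝓝 0) := by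
    have := (tendsto_add_atTop_iff_nat (f := fun n : ℕ => ((n : ℝ≥0∞))⁻¹) 1).2
      ENNReal.tendsto_inv_nat_nhds_zero
    simpa using this
  have hlim : Tendsto (fun n => eLpNorm (g n - H) 2 μ) atTop (𝓝 0) := by
    refine tendsto_of_tendsto_of_tendsto_of_le_of_le tendsto_const_nhds hε0
      (fun n => zero_le) fun n => ?_
    simp only
    rw [eLpNorm_sub_comm]
    exact hgn n
  obtain ⟨ns, hns, hae⟩ := (tendstoInMeasure_of_tendsto_eLpNorm two_ne_zero
    (fun n => (hgc n).aestronglyMeasurable) hH.1 hlim).exists_seq_tendsto_ae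
  calc ∫⁻ x, ‖H x‖ₑ ∂m = ∫⁻ x, liminf (fun n => ‖g (ns n) x‖ₑ) atTop ∂m := by
        refine lintegral_congr_ae ?_
        filter_upwards [hac.ae_le hae] with x hx
        exact hx.enorm.liminf_eq.symm
    _ ≤ liminf (fun n => ∫⁻ x, ‖g (ns n) x‖ₑ ∂m) atTop :=
        lintegral_liminf_le fun n => (hgc _).enorm.measurable
    _ ≤ liminf (fun n => C * (eLpNorm H 2 μ + ((ns n : ℝ≥0∞) + 1)⁻¹)) atTop := by
        refine liminf_le_liminf (Eventually.of_forall fun n => ?_)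
        refine (h _ (hgc _) (hgs _)).trans ?_
        gcongr
        calc eLpNorm (g (ns n)) 2 μ = eLpNorm (H - (H - g (ns n))) 2 μ := by rw [_root_.sub_sub_cancel]
          _ ≤ eLpNorm H 2 μ + eLpNorm (H - g (ns n)) 2 μ :=
              eLpNorm_sub_le hH.1 (hH.1.sub (hgc _).aestronglyMeasurable) one_le_two
          _ ≤ _ := by gcongr; exact hgn _
    _ = C * eLpNorm H 2 μ := by
        refine Tendsto.liminf_eq ?_
        have h1 := (hε0.comp hns.tendsto_atTop).const_add (eLpNorm H 2 μ)
        rw [add_zero] at h1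
        exact ENNReal.Tendsto.const_mul h1 (Or.inr hC)

end MeasureBound

/-! ### The bound along q and the transfer identity for G in L². -/

section QuadraticBound

section Definition

variable {k : Type*} [NontriviallyNormedField k] [MeasurableSpace k] [BorelSpace k]
  {V : Type*} [AddCommGroup V] [Module k V] [TopologicalSpace V] [MeasurableSpace V] [BorelSpace V]
  {μ : Measure k} {ν : Measure V} {q : QuadraticForm k V}

/-- The functional `H ↦ ∫ |H(q(X)) φ(X)| dX` is bounded on `L²(k)`. -/
def IsQuadraticallyBounded (μ : Measure k) (ν : Measure V) (q : QuadraticForm k V) (φ : V → ℂ) :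
    Prop :=
  ∃ C : ℝ≥0∞, C ≠ ∞ ∧ ∀ H : k → ℂ, Measurable H → MemLp H 2 μ →
    ∫⁻ X, ‖φ X‖ₑ * ‖H (q X)‖ₑ ∂ν ≤ C * eLpNorm H 2 μ

/-- The indicator of a null set has zero L² norm, so its pullback by q is null for |φ| dX. Thus φ ·
(H ∘ q) depends only on the almost everywhere class of H. -/
lemma IsQuadraticallyBounded.ae_of_ae {φ : V → ℂ} (hb : IsQuadraticallyBounded μ ν q φ)
    (hφc : Continuous φ) (hqc : Continuous q) {P : k → Prop} (hP : ∀ᵐ x ∂μ, P x) :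
    ∀ᵐ X ∂ν, φ X ≠ 0 → P (q X) := by
  obtain ⟨C, hC, h⟩ := hb
  obtain ⟨s, hs, hsm, hs0⟩ := exists_measurable_superset_of_null (ae_iff.1 hP)
  have hnull : eLpNorm (s.indicator fun _ => (1 : ℂ)) 2 μ = 0 := by
    refine (eLpNorm_eq_zero_iff (aestronglyMeasurable_const.indicator hsm) two_ne_zero).2 ?_
    exact indicator_meas_zero hs0
  have h1 := h (s.indicator fun _ => 1) (measurable_const.indicator hsm)
    ⟨aestronglyMeasurable_const.indicator hsm, hnull ▸ zero_lt_top⟩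
  rw [hnull, mul_zero, nonpos_iff_eq_zero, lintegral_eq_zero_iff] at h1
  · filter_upwards [h1] with X hX hφX
    by_contra hPX
    have : q X ∈ s := hs hPX
    simp [this, hφX] at hX
  · exact hφc.enorm.measurable.mul
      ((measurable_const.indicator hsm).enorm.comp hqc.measurable)

lemma IsQuadraticallyBounded.exists_bound {φ : V → ℂ} (hb : IsQuadraticallyBounded μ ν q φ)
    (hφc : Continuous φ) (hqc : Continuous q) :
    ∃ C : ℝ≥0∞, C ≠ ∞ ∧ ∀ H : k → ℂ, MemLp H 2 μ →
      ∫⁻ X, ‖φ X‖ₑ * ‖H (q X)‖ₑ ∂ν ≤ C * eLpNorm H 2 μ := by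
  obtain ⟨C, hC, h⟩ := id hb
  refine ⟨C, hC, fun H hH => ?_⟩
  have hae := hb.ae_of_ae hφc hqc hH.1.ae_eq_mk
  rw [eLpNorm_congr_ae hH.1.ae_eq_mk]
  refine le_trans (le_of_eq (lintegral_congr_ae ?_))
    (h _ hH.1.stronglyMeasurable_mk.measurable (hH.ae_eq hH.1.ae_eq_mk))
  filter_upwards [hae] with X hX
  by_cases h0 : φ X = 0
  · simp [h0]
  · rw [hX h0]

end Definition

variable {k : Type*} [NontriviallyNormedField k] [LocallyCompactSpace k]
  [MeasurableSpace k] [BorelSpace k] [CharZero k]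
  {V : Type*} [AddCommGroup V] [Module k V] [FiniteDimensional k V]
  [TopologicalSpace V] [IsTopologicalAddGroup V] [ContinuousSMul k V] [T2Space V]
  [MeasurableSpace V] [BorelSpace V]
  {ψ : AddChar k Circle} {μ : Measure k} {ν : Measure V} {q : QuadraticForm k V} {K : k → ℂ}

variable [μ.IsAddHaarMeasure] [ν.IsAddHaarMeasure]

/-- Cauchy–Schwarz, with F_qφ in L² and the transform bounded in L² norm. Integrability of G serves
only to define its transform; the bound sees ‖G‖₂ alone. -/
lemma exists_lintegral_fourier_mul_le (hψ : Continuous ψ) (hK : IsSummationKernel ψ μ K)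
    (hV : 2 ≤ Module.finrank k V) (hν : IsSelfDual ψ (QuadraticMap.polarBilin q) ν)
    {φ : V → ℂ} (hφc : Continuous φ) (hφ : Integrable φ ν)
    (hφ' : Integrable (bilinFourier ψ (QuadraticMap.polarBilin q) ν φ) ν) :
    ∃ C : ℝ≥0∞, C ≠ ∞ ∧ ∀ G : k → ℂ, Integrable G μ →
      ∫⁻ t, ‖fourierField ψ μ G t * fourierQuad ψ q ν φ (-t)‖ₑ ∂μ ≤ C * eLpNorm G 2 μ := by
  have hF := lintegral_fourierQuad_sq_lt_top hψ q hV μ hν hφc hφ hφ'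
  have hFc := continuous_fourierQuad hψ q hφ
  refine ⟨(2 * ∫⁻ z, ‖fourierField ψ μ K z‖ₑ ∂μ) ^ (1 / 2 : ℝ) *
    (∫⁻ t, ‖fourierQuad ψ q ν φ t‖ₑ ^ 2 ∂μ) ^ (1 / 2 : ℝ), ?_, fun G hG => ?_⟩
  · refine ENNReal.mul_ne_top (ENNReal.rpow_ne_top_of_nonneg (by norm_num) ?_)
      (ENNReal.rpow_ne_top_of_nonneg (by norm_num) hF.ne)
    exact ENNReal.mul_ne_top ENNReal.ofNat_ne_top hK.integrable_fourier.2.ne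
  · have hGc := continuous_fourierField hψ hG
    simp_rw [enorm_mul]
    calc ∫⁻ t, ‖fourierField ψ μ G t‖ₑ * ‖fourierQuad ψ q ν φ (-t)‖ₑ ∂μ
        ≤ (∫⁻ t, ‖fourierField ψ μ G t‖ₑ ^ (2 : ℝ) ∂μ) ^ (1 / 2 : ℝ) *
          (∫⁻ t, ‖fourierQuad ψ q ν φ (-t)‖ₑ ^ (2 : ℝ) ∂μ) ^ (1 / 2 : ℝ) :=
          ENNReal.lintegral_mul_le_Lp_mul_Lq μ Real.HolderConjugate.two_two
            hGc.enorm.measurable.aemeasurable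
            (hFc.comp continuous_neg).enorm.measurable.aemeasurable
      _ ≤ (2 * (∫⁻ z, ‖fourierField ψ μ K z‖ₑ ∂μ) * ∫⁻ x, ‖G x‖ₑ ^ 2 ∂μ) ^ (1 / 2 : ℝ) *
          (∫⁻ t, ‖fourierQuad ψ q ν φ t‖ₑ ^ 2 ∂μ) ^ (1 / 2 : ℝ) := by
          simp_rw [ENNReal.rpow_two]
          rw [lintegral_neg_eq_self (fun t => ‖fourierQuad ψ q ν φ t‖ₑ ^ 2)]
          gcongr
          exact lintegral_fourierField_sq_le hψ hK hG
      _ = _ := by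
          rw [ENNReal.mul_rpow_of_nonneg _ _ (by norm_num), eLpNorm_two_eq]
          ring

lemma integral_fourier_mul_eq_of_compactSupport (hψ : Continuous ψ)
    (hSD : IsSelfDual ψ (LinearMap.mul k k) μ) (hK : IsSummationKernel ψ μ K)
    (hV : 2 ≤ Module.finrank k V) (hν : IsSelfDual ψ (QuadraticMap.polarBilin q) ν)
    {φ : V → ℂ} (hφc : Continuous φ) (hφ : Integrable φ ν)
    (hφ' : Integrable (bilinFourier ψ (QuadraticMap.polarBilin q) ν φ) ν)
    {g : k → ℂ} (hgc : Continuous g) (hgs : HasCompactSupport g) :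
    ∫ t, fourierField ψ μ g t * fourierQuad ψ q ν φ (-t) ∂μ = ∫ X, φ X * g (q X) ∂ν := by
  have : SecondCountableTopology V := secondCountable_of_finiteDimensional k V
  have : LocallyCompactSpace V := locallyCompact_of_finiteDimensional k V
  obtain ⟨D, hD⟩ := hgs.exists_bound_of_continuous hgc
  obtain ⟨C, hC, h⟩ := exists_lintegral_fourier_mul_le hψ hK hV hν hφc hφ hφ'
  have hgi : Integrable g μ := hgc.integrable_of_hasCompactSupport hgs
  refine integral_fourierField_mul_integral hψ hSD hK hgc hgi hD hφ
    (continuous_quadraticForm q).measurable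
    ⟨((continuous_fourierField hψ hgi).mul
      ((continuous_fourierQuad hψ q hφ).comp continuous_neg)).aestronglyMeasurable, ?_⟩
  refine (h g hgi).trans_lt (ENNReal.mul_lt_top hC.lt_top ?_)
  exact (hgc.memLp_of_hasCompactSupport hgs).2

/-- A nonnegative function with integrable Fourier transform is quadratically bounded. -/
theorem isQuadraticallyBounded_of_nonneg (hψ : Continuous ψ)
    (hSD : IsSelfDual ψ (LinearMap.mul k k) μ) (hK : IsSummationKernel ψ μ K)
    (hV : 2 ≤ Module.finrank k V) (hν : IsSelfDual ψ (QuadraticMap.polarBilin q) ν)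
    {φ : V → ℂ} (hφc : Continuous φ) (hφ : Integrable φ ν)
    (hφ' : Integrable (bilinFourier ψ (QuadraticMap.polarBilin q) ν φ) ν)
    (hφ0 : ∀ X, ((‖φ X‖ : ℝ) : ℂ) = φ X) : IsQuadraticallyBounded μ ν q φ := by
  have : SecondCountableTopology V := secondCountable_of_finiteDimensional k V
  have hqc := continuous_quadraticForm q
  obtain ⟨C, hC, h⟩ := exists_lintegral_fourier_mul_le hψ hK hV hν hφc hφ hφ'
  -- The claim is an L² bound for this finite measure m. As φ ≥ 0, ∫ |g| dm is the right side of the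
  -- transfer identity for |g|, and the left side is already bounded.
  set m : Measure k := (ν.withDensity fun X => ‖φ X‖ₑ).map q with hm
  have hfin : IsFiniteMeasure (ν.withDensity fun X => ‖φ X‖ₑ) :=
    isFiniteMeasure_withDensity hφ.2.ne
  have : IsFiniteMeasure m := Measure.isFiniteMeasure_map _ _
  have hdens : ∀ f : V → ℝ≥0∞, ∫⁻ X, f X ∂(ν.withDensity fun X => ‖φ X‖ₑ) =
      ∫⁻ X, ‖φ X‖ₑ * f X ∂ν := fun f =>
    lintegral_withDensity_eq_lintegral_mul_non_measurable _ hφc.enorm.measurable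
      (Eventually.of_forall fun X => enorm_lt_top) f
  have hcpt : ∀ g : k → ℂ, Continuous g → HasCompactSupport g →
      ∫⁻ x, ‖g x‖ₑ ∂m ≤ C * eLpNorm g 2 μ := by
    intro g hgc hgs
    have hgc' : Continuous fun x => ((‖g x‖ : ℝ) : ℂ) := by fun_prop
    have hgs' : HasCompactSupport fun x => ((‖g x‖ : ℝ) : ℂ) :=
      hgs.comp_left (g := fun z : ℂ => ((‖z‖ : ℝ) : ℂ)) (by simp)
    have hgi' : Integrable (fun x => ((‖g x‖ : ℝ) : ℂ)) μ :=
      hgc'.integrable_of_hasCompactSupport hgs'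
    have hid := integral_fourier_mul_eq_of_compactSupport hψ hSD hK hV hν hφc hφ hφ' hgc' hgs'
    have hnorm : eLpNorm (fun x => ((‖g x‖ : ℝ) : ℂ)) 2 μ = eLpNorm g 2 μ :=
      eLpNorm_congr_norm_ae (Eventually.of_forall fun x => by simp)
    obtain ⟨D, hD⟩ := hgs.exists_bound_of_continuous hgc
    have hI : Integrable (fun X => ‖φ X‖ * ‖g (q X)‖) ν :=
      hφ.norm.mul_bdd (c := D) (Continuous.aestronglyMeasurable (by fun_prop))
        (Eventually.of_forall fun X => by simpa using hD (q X))
    have h0 : 0 ≤ ∫ X, ‖φ X‖ * ‖g (q X)‖ ∂ν := integral_nonneg fun X => by positivity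
    calc ∫⁻ x, ‖g x‖ₑ ∂m = ∫⁻ X, ‖φ X‖ₑ * ‖g (q X)‖ₑ ∂ν := by
          rw [hm, lintegral_map hgc.enorm.measurable hqc.measurable, hdens]
      _ = ‖∫ X, φ X * ((‖g (q X)‖ : ℝ) : ℂ) ∂ν‖ₑ := by
          have h1 : ∫ X, φ X * ((‖g (q X)‖ : ℝ) : ℂ) ∂ν =
              ((∫ X, ‖φ X‖ * ‖g (q X)‖ ∂ν : ℝ) : ℂ) := by
            rw [← integral_complex_ofReal]
            refine integral_congr_ae (Eventually.of_forall fun X => ?_)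
            simp only [Complex.ofReal_mul, hφ0]
          rw [h1, ← ofReal_norm, Complex.norm_real, Real.norm_of_nonneg h0,
            ofReal_integral_eq_lintegral_ofReal hI (Eventually.of_forall fun t => by positivity)]
          refine lintegral_congr fun t => ?_
          rw [ENNReal.ofReal_mul (by positivity), ofReal_norm, ofReal_norm]
      _ ≤ C * eLpNorm g 2 μ := by
          rw [← hid, ← hnorm]
          exact (enorm_integral_le_lintegral_enorm _).trans (h _ hgi')
  refine ⟨C, hC, fun H _ hH => ?_⟩
  have hac := absolutelyContinuous_of_lintegral_le hC hcpt
  have := lintegral_le_of_forall_compactSupport hC hcpt hH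
  rwa [hm, lintegral_map' (hH.1.mono_ac hac).enorm hqc.aemeasurable, hdens] at this

/-- Transfer of a square integrable function through the Fourier transform. -/
theorem integral_fourier_mul_fourierQuad (hψ : Continuous ψ)
    (hSD : IsSelfDual ψ (LinearMap.mul k k) μ) (hK : IsSummationKernel ψ μ K)
    (hV : 2 ≤ Module.finrank k V) (hν : IsSelfDual ψ (QuadraticMap.polarBilin q) ν)
    {φ : V → ℂ} (hφc : Continuous φ) (hφ : Integrable φ ν)
    (hφ' : Integrable (bilinFourier ψ (QuadraticMap.polarBilin q) ν φ) ν)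
    (hb : IsQuadraticallyBounded μ ν q φ) {G : k → ℂ} (hG : Integrable G μ)
    (hG2 : MemLp G 2 μ) :
    Integrable (fun t => fourierField ψ μ G t * fourierQuad ψ q ν φ (-t)) μ ∧
    Integrable (fun X => φ X * G (q X)) ν ∧
    ∫ t, fourierField ψ μ G t * fourierQuad ψ q ν φ (-t) ∂μ = ∫ X, φ X * G (q X) ∂ν := by
  have : SecondCountableTopology V := secondCountable_of_finiteDimensional k V
  have hqc := continuous_quadraticForm q
  obtain ⟨C, hC, h⟩ := exists_lintegral_fourier_mul_le hψ hK hV hν hφc hφ hφ'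
  obtain ⟨D, hD, hbd⟩ := hb.exists_bound hφc hqc
  have hI1 : ∀ G : k → ℂ, Integrable G μ → MemLp G 2 μ →
      Integrable (fun t => fourierField ψ μ G t * fourierQuad ψ q ν φ (-t)) μ := fun G hG hG2 =>
    ⟨((continuous_fourierField hψ hG).mul
      ((continuous_fourierQuad hψ q hφ).comp continuous_neg)).aestronglyMeasurable,
      (h G hG).trans_lt (ENNReal.mul_lt_top hC.lt_top hG2.2)⟩
  have hI2 : ∀ G : k → ℂ, MemLp G 2 μ → Integrable (fun X => φ X * G (q X)) ν := by
    intro G hG2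
    refine ⟨?_, ?_⟩
    · have hae := hb.ae_of_ae hφc hqc hG2.1.ae_eq_mk
      refine AEStronglyMeasurable.congr (f := fun X => φ X * hG2.1.mk G (q X)) ?_ ?_
      · exact (hφc.measurable.mul
          (hG2.1.stronglyMeasurable_mk.measurable.comp hqc.measurable)).aestronglyMeasurable
      · filter_upwards [hae] with X hX
        by_cases h0 : φ X = 0
        · simp [h0]
        · rw [hX h0]
    · refine lt_of_le_of_lt (le_of_eq ?_)
        ((hbd G hG2).trans_lt (ENNReal.mul_lt_top hD.lt_top hG2.2))
      simp [enorm_mul]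
  refine ⟨hI1 G hG hG2, hI2 G hG2, ?_⟩
  rw [← sub_eq_zero, ← enorm_eq_zero]
  refine le_antisymm (_root_.le_of_forall_pos_le_add fun ε hε => ?_) zero_le
  rw [zero_add]
  have ht : Tendsto (fun r : ℝ≥0∞ => (C + D) * r) (𝓝 0) (𝓝 0) := by
    have := ENNReal.Tendsto.const_mul (a := C + D) (tendsto_id (α := ℝ≥0∞) (x := 𝓝 0))
      (Or.inr (ENNReal.add_ne_top.2 ⟨hC, hD⟩))
    simpa using this
  -- r is an L² error small enough that (C + D) r ≤ ε, where C and D are the continuity constants of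
  -- the two sides.
  obtain ⟨r, hr, hr0⟩ := (((ht.mono_left nhdsWithin_le_nhds).eventually_le_const hε).and
    (self_mem_nhdsWithin : Set.Ioi (0 : ℝ≥0∞) ∈ 𝓝[>] 0)).exists
  obtain ⟨g, hgs, hgn, hgc, hgm⟩ :=
    hG2.exists_hasCompactSupport_eLpNorm_sub_le ENNReal.ofNat_ne_top (ne_of_gt hr0)
  have hgi : Integrable g μ := hgc.integrable_of_hasCompactSupport hgs
  have hid := integral_fourier_mul_eq_of_compactSupport hψ hSD hK hV hν hφc hφ hφ' hgc hgs
  have hsub : ∀ t, fourierField ψ μ (G - g) t = fourierField ψ μ G t - fourierField ψ μ g t := by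
    intro t
    simp only [fourierField_apply, Pi.sub_apply, sub_mul]
    exact integral_sub (integrable_mul_char hψ hG (by fun_prop))
      (integrable_mul_char hψ hgi (by fun_prop))
  have e1 : ∫ t, fourierField ψ μ G t * fourierQuad ψ q ν φ (-t) ∂μ -
      ∫ t, fourierField ψ μ g t * fourierQuad ψ q ν φ (-t) ∂μ =
      ∫ t, fourierField ψ μ (G - g) t * fourierQuad ψ q ν φ (-t) ∂μ := by
    rw [← integral_sub (hI1 G hG hG2) (hI1 g hgi hgm)]
    simp_rw [hsub, sub_mul]
  have e2 : ∫ X, φ X * G (q X) ∂ν - ∫ X, φ X * g (q X) ∂ν = ∫ X, φ X * (G - g) (q X) ∂ν := by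
    rw [← integral_sub (hI2 G hG2) (hI2 g hgm)]
    simp_rw [Pi.sub_apply, mul_sub]
  calc ‖∫ t, fourierField ψ μ G t * fourierQuad ψ q ν φ (-t) ∂μ - ∫ X, φ X * G (q X) ∂ν‖ₑ
      = ‖(∫ t, fourierField ψ μ (G - g) t * fourierQuad ψ q ν φ (-t) ∂μ) -
          ∫ X, φ X * (G - g) (q X) ∂ν‖ₑ := by
        rw [← e1, ← e2, hid, sub_sub_sub_cancel_right]
    _ ≤ ‖∫ t, fourierField ψ μ (G - g) t * fourierQuad ψ q ν φ (-t) ∂μ‖ₑ +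
          ‖∫ X, φ X * (G - g) (q X) ∂ν‖ₑ := enorm_sub_le
    _ ≤ C * eLpNorm (G - g) 2 μ + D * eLpNorm (G - g) 2 μ := by
        gcongr
        · exact (enorm_integral_le_lintegral_enorm _).trans (h _ (hG.sub hgi))
        · refine (enorm_integral_le_lintegral_enorm _).trans (le_trans (le_of_eq ?_)
            (hbd _ (hG2.sub hgm)))
          simp [enorm_mul]
    _ ≤ (C + D) * r := by
        rw [← add_mul]
        gcongr
    _ ≤ ε := hr

end QuadraticBound

/-! ### Fourier transforms in the locally constant case. -/

section LocallyConstant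

lemma exists_uniform_locallyConstant {E : Type*} [NormedAddCommGroup E] {f : E → ℂ}
    (hf : IsLocallyConstant f) (hc : HasCompactSupport f) :
    ∃ r > 0, ∀ x z : E, ‖z‖ < r → f (x + z) = f x := by
  obtain ⟨r, hr, h⟩ := lebesgue_number_lemma_of_metric (s := tsupport f)
    (c := fun i : ℂ => f ⁻¹' {i}) hc (fun i => hf {i}) (fun x _ => by simp)
  refine ⟨r, hr, fun x z hz => ?_⟩
  by_cases hx : x ∈ tsupport f
  · obtain ⟨i, hi⟩ := h x hx
    have h1 : f x = i := hi (Metric.mem_ball_self hr)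
    have h2 : f (x + z) = i := hi (by simpa using hz)
    rw [h1, h2]
  · by_cases hxz : x + z ∈ tsupport f
    · obtain ⟨i, hi⟩ := h _ hxz
      have h1 : f (x + z) = i := hi (Metric.mem_ball_self hr)
      have h2 : f x = i := hi (by simpa [dist_eq_norm] using hz)
      rw [h1, h2]
    · rw [image_eq_zero_of_notMem_tsupport hx, image_eq_zero_of_notMem_tsupport hxz]

variable {k : Type*} [NontriviallyNormedField k] [LocallyCompactSpace k]
  [MeasurableSpace k] [BorelSpace k]
  {V : Type*} [AddCommGroup V] [Module k V] [FiniteDimensional k V]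
  [TopologicalSpace V] [IsTopologicalAddGroup V] [ContinuousSMul k V] [T2Space V]
  [MeasurableSpace V] [BorelSpace V]
  {ψ : AddChar k Circle} {ν : Measure V} [ν.IsAddHaarMeasure]

/-- The Fourier transform of a locally constant function of compact support is integrable. -/
theorem integrable_bilinFourier_of_isLocallyConstant (hψ : Continuous ψ) (hψ1 : ψ ≠ 1)
    (B : LinearMap.BilinForm k V) (hB : ∀ Y, (∀ X, B X Y = 0) → Y = 0) {φ : V → ℂ}
    (hφ : IsLocallyConstant φ) (hφc : HasCompactSupport φ) :
    Integrable (bilinFourier ψ B ν φ) ν := by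
  have : SecondCountableTopology V := secondCountable_of_finiteDimensional k V
  have hφi : Integrable φ ν := hφ.continuous.integrable_of_hasCompactSupport hφc
  let e := coords k V
  let b := (Pi.basisFun k (Fin (Module.finrank k V))).map e.symm.toLinearEquiv
  obtain ⟨r, hr, hconst⟩ := exists_uniform_locallyConstant
    (f := fun x => φ (e.symm x)) (hφ.comp_continuous e.symm.continuous)
    (hφc.comp_homeomorph e.symm.toHomeomorph)
  have hconst' : ∀ X Z : V, ‖e Z‖ < r → φ (X + Z) = φ X := by
    intro X Z hZ
    simpa using hconst (e X) (e Z) hZ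
  -- Translation by such a Z fixes φ but multiplies its transform at Y by ψ(B(Z, Y)).
  have hker : ∀ Y Z, bilinFourier ψ B ν φ Y ≠ 0 → ‖e Z‖ < r → ψ (B Z Y) = 1 := by
    intro Y Z hY hZ
    have h : bilinFourier ψ B ν φ Y = (ψ (B Z Y) : ℂ) * bilinFourier ψ B ν φ Y := by
      conv_lhs => rw [bilinFourier, ← integral_add_right_eq_self _ Z]
      rw [bilinFourier, ← integral_const_mul]
      refine integral_congr_ae (Eventually.of_forall fun X => ?_)
      simp only [hconst' X Z hZ, map_add, LinearMap.add_apply, char_add]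
      ring
    have h1 : (ψ (B Z Y) : ℂ) = 1 := by
      have : ((ψ (B Z Y) : ℂ) - 1) * bilinFourier ψ B ν φ Y = 0 := by
        rw [sub_mul, one_mul, ← h, _root_.sub_self]
      rcases mul_eq_zero.1 this with h0 | h0
      · exact sub_eq_zero.1 h0
      · exact absurd h0 hY
    exact Circle.ext h1
  obtain ⟨a, ha⟩ : ∃ a, ψ a ≠ 1 := by
    by_contra! hcon
    exact hψ1 (DFunLike.ext _ _ fun a => by simpa using hcon a)
  -- Nondegeneracy makes the values B(bᵢ, Y) coordinates of Y, so bounding them confines the support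
  -- of the transform to a compact set.
  let T : V →ₗ[k] (Fin (Module.finrank k V) → k) := LinearMap.pi fun i => B (b i)
  have hT : Function.Injective T := by
    rw [injective_iff_map_eq_zero]
    intro Y hY
    refine hB Y fun X => ?_
    have hb : B.flip Y = 0 := b.ext fun i => congrFun hY i
    exact LinearMap.congr_fun hb X
  let T' : V ≃L[k] (Fin (Module.finrank k V) → k) :=
    (T.linearEquivOfInjective hT (by simp)).toContinuousLinearEquiv
  have hT' : ∀ Y, T' Y = T Y := fun Y => rfl
  have hsupp : HasCompactSupport (bilinFourier ψ B ν φ) := by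
    refine HasCompactSupport.of_support_subset_isCompact
      ((isCompact_closedBall (0 : Fin (Module.finrank k V) → k) (‖a‖ / r)).image
        T'.symm.continuous) fun Y hY => ?_
    refine ⟨T' Y, ?_, T'.symm_apply_apply Y⟩
    rw [mem_closedBall_zero_iff, pi_norm_le_iff_of_nonneg (by positivity)]
    intro i
    change ‖B (b i) Y‖ ≤ _
    by_cases h0 : B (b i) Y = 0
    · rw [h0, norm_zero]; positivity
    by_contra! hlt
    have hpos : 0 < ‖B (b i) Y‖ := norm_pos_iff.2 h0
    -- If B(bᵢ, Y) were large, this multiple of bᵢ would lie in the invariance ball, yet its pairing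
    -- with Y is a, where ψ is nontrivial.
    have hs : ‖e ((a / B (b i) Y) • b i)‖ < r := by
      have : e (b i) = Pi.single i 1 := by simp [b]
      rw [map_smul, this, norm_smul, norm_div, Pi.norm_single, norm_one, mul_one,
        div_lt_iff₀ hpos]
      rwa [div_lt_iff₀ hr, mul_comm] at hlt
    have := hker Y _ hY hs
    rw [map_smul, LinearMap.smul_apply, smul_eq_mul, div_mul_cancel₀ _ h0] at this
    exact ha this
  exact (continuous_bilinFourier hψ B hφi).integrable_of_hasCompactSupport hsupp

end LocallyConstant

/-! ### Reduction of the archimedean case to Euclidean Fourier analysis. -/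

section Archimedean

/-- A continuous character of a real normed space is given by a linear functional. -/
theorem exists_fourierChar_eq {E : Type*} [NormedAddCommGroup E] [NormedSpace ℝ E]
    (χ : AddChar E Circle) (hχ : Continuous χ) :
    ∃ L : E →L[ℝ] ℝ, ∀ x, χ x = Real.fourierChar (L x) := by
  have cov : IsCoveringMap ((↑) : ℝ → AddCircle (2 * Real.pi)) := AddCircle.isCoveringMap_coe _
  let f : C(E, AddCircle (2 * Real.pi)) :=
    ⟨fun x => AddCircle.homeomorphCircle'.symm (χ x),
      AddCircle.homeomorphCircle'.symm.continuous.comp hχ⟩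
  have hexp : ∀ (r : ℝ) (x : E), (r : AddCircle (2 * Real.pi)) = f x ↔ Circle.exp r = χ x := by
    intro r x
    rw [← AddCircle.homeomorphCircle'_apply_mk]
    exact (Equiv.eq_symm_apply _)
  obtain ⟨F, ⟨hF0, hF⟩, huniq⟩ := cov.existsUnique_continuousMap_lifts f 0 0
    ((hexp 0 0).2 (by simp))
  have hF' : ∀ x, Circle.exp (F x) = χ x := fun x => (hexp _ _).1 (congrFun hF x)
  have hadd : ∀ x y, F (x + y) = F x + F y := by
    intro x y
    -- This is another lift of χ vanishing at 0, so uniqueness of lifts forces F to be additive.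
    have h := huniq ⟨fun z => F (z + y) - F y, by fun_prop⟩ ⟨by simp, funext fun z => ?_⟩
    · have := congrArg (fun g : C(E, ℝ) => g x) h
      simp only [ContinuousMap.coe_mk] at this
      linarith
    · refine (hexp _ _).2 ?_
      simp only [ContinuousMap.coe_mk]
      rw [Circle.exp_sub, hF', hF', AddChar.map_add_eq_mul, mul_div_cancel_right]
  let F' : E →L[ℝ] ℝ := (AddMonoidHom.mk' F hadd).toRealLinearMap F.continuous
  refine ⟨(2 * Real.pi)⁻¹ • F', fun x => ?_⟩
  have h1 : Real.fourierChar (((2 * Real.pi)⁻¹ • F') x) =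
      Circle.exp (2 * Real.pi * ((2 * Real.pi)⁻¹ * F x)) := rfl
  rw [h1, mul_inv_cancel_left₀ (by positivity), hF']

lemma integrable_comp_continuousAddEquiv {V : Type*} [AddCommGroup V]
    [TopologicalSpace V] [IsTopologicalAddGroup V] [MeasurableSpace V] [BorelSpace V]
    {ν : Measure V} [ν.IsAddHaarMeasure] {N : ℕ} (e : V ≃ₜ+ EuclideanSpace ℝ (Fin N))
    (f : SchwartzMap (EuclideanSpace ℝ (Fin N)) ℂ) : Integrable (fun X => f (e X)) ν := by
  have : (ν.map e).IsAddHaarMeasure := e.isAddHaarMeasure_map ν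
  have h : Integrable f (ν.map e) := f.integrable
  exact (e.toHomeomorph.measurableEmbedding.integrable_map_iff).1 h

variable {k : Type*} [NontriviallyNormedField k] [LocallyCompactSpace k]
  {V : Type*} [AddCommGroup V] [Module k V]
  [TopologicalSpace V] [IsTopologicalAddGroup V] [ContinuousSMul k V] [T2Space V]

/-- If a nonzero vector space over `k` is topologically a real vector space, so is `k`. -/
theorem exists_continuousAddEquiv_euclidean [CharZero k] [Nontrivial V] {N : ℕ}
    (e : V ≃ₜ+ EuclideanSpace ℝ (Fin N)) :
    ∃ d : ℕ, Nonempty (k ≃ₜ+ EuclideanSpace ℝ (Fin d)) := by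
  obtain ⟨v, hv⟩ := exists_ne (0 : V)
  let ι : k →+ EuclideanSpace ℝ (Fin N) :=
    { toFun := fun a => e (a • v)
      map_zero' := by simp
      map_add' := fun a b => by rw [add_smul, map_add] }
  have hι : IsClosedEmbedding ι :=
    e.toHomeomorph.isClosedEmbedding.comp (isClosedEmbedding_smul_left hv)
  let S : Submodule ℝ (EuclideanSpace ℝ (Fin N)) :=
    { carrier := Set.range ι
      add_mem' := by
        rintro _ _ ⟨a, rfl⟩ ⟨b, rfl⟩
        exact ⟨a + b, map_add ι a b⟩
      zero_mem' := ⟨0, map_zero ι⟩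
      smul_mem' := by
        rintro c _ ⟨a, rfl⟩
        have hcl : IsClosed {c : ℝ | c • ι a ∈ Set.range ι} :=
          hι.isClosed_range.preimage (by fun_prop)
        -- In characteristic zero the image of the line kv is stable under ℚ; being closed, it is
        -- stable under ℝ.
        refine isClosed_property Rat.denseRange_cast hcl (fun r => ?_) c
        refine ⟨r • a, ?_⟩
        rw [map_rat_smul, Rat.cast_smul_eq_qsmul] }
  let g₀ : k ≃ₜ S := hι.toIsEmbedding.toHomeomorph
  let g : k ≃ₜ+ S :=
    { g₀ with map_add' := fun a b => Subtype.ext (map_add ι a b) }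
  let h : S ≃ₜ+ EuclideanSpace ℝ (Fin (Module.finrank ℝ S)) :=
    (toEuclidean (E := S)).toContinuousAddEquiv
  exact ⟨_, ⟨g.trans h⟩⟩

variable [FiniteDimensional k V] [MeasurableSpace V] [BorelSpace V]
  {ψ : AddChar k Circle} {ν : Measure V} [ν.IsAddHaarMeasure]

/-- The Fourier transform of a Schwartz function is integrable. -/
theorem integrable_bilinFourier_of_schwartz (hψ : Continuous ψ) (hψ1 : ψ ≠ 1)
    (B : LinearMap.BilinForm k V) (hB : ∀ Y, (∀ X, B X Y = 0) → Y = 0) {d N : ℕ}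
    (g : k ≃ₜ+ EuclideanSpace ℝ (Fin d)) (e : V ≃ₜ+ EuclideanSpace ℝ (Fin N))
    (f : SchwartzMap (EuclideanSpace ℝ (Fin N)) ℂ) :
    Integrable (bilinFourier ψ B ν fun X => f (e X)) ν := by
  have hBc := continuous_bilin B
  let χ : AddChar (EuclideanSpace ℝ (Fin d)) Circle :=
    { toFun := fun x => ψ (g.symm x)
      map_zero_eq_one' := by simp
      map_add_eq_mul' := fun x y => by rw [map_add, AddChar.map_add_eq_mul] }
  obtain ⟨L, hL⟩ := exists_fourierChar_eq χ (hψ.comp g.symm.continuous)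
  have hψL : ∀ a, ψ a = Real.fourierChar (L (g a)) := fun a => by
    rw [← hL]
    simp [χ]
  let β : EuclideanSpace ℝ (Fin N) → EuclideanSpace ℝ (Fin N) → ℝ :=
    fun x y => L (g (B (e.symm x) (e.symm y)))
  have hgc := g.continuous
  have hec := e.symm.continuous
  have hβ₁ : ∀ y, Continuous fun x => β x y := fun y => L.continuous.comp (hgc.comp
    (hBc.comp (by fun_prop : Continuous fun x => (e.symm x, e.symm y))))
  have hβ₂ : ∀ x, Continuous (β x) := fun x => L.continuous.comp (hgc.comp
    (hBc.comp (by fun_prop : Continuous fun y => (e.symm x, e.symm y))))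
  let bx : ∀ _ : EuclideanSpace ℝ (Fin N), EuclideanSpace ℝ (Fin N) →L[ℝ] ℝ := fun y =>
    (AddMonoidHom.mk' (fun x => β x y) fun x x' => by simp [β]).toRealLinearMap (hβ₁ y)
  -- T represents β by the inner product, so the transform for ψ(B) becomes the Euclidean one
  -- composed with a linear map.
  let T₀ : EuclideanSpace ℝ (Fin N) →+ EuclideanSpace ℝ (Fin N) :=
    AddMonoidHom.mk' (fun y => WithLp.toLp 2 fun i => β (EuclideanSpace.single i 1) y)
      fun y y' => by ext i; simp [β]
  have hT₀ : Continuous T₀ :=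
    (PiLp.continuous_toLp 2 _).comp (continuous_pi fun i => hβ₂ _)
  let T := T₀.toRealLinearMap hT₀
  have hTβ : ∀ x y, inner ℝ x (T y) = β x y := by
    intro x y
    have hx : x = ∑ i, x i • EuclideanSpace.single i (1 : ℝ) := by
      ext j
      simp [Finset.sum_apply, Pi.single_apply]
    have h1 : β x y = bx y x := rfl
    rw [h1]
    conv_rhs => rw [hx, map_sum]
    simp only [map_smul, smul_eq_mul, PiLp.inner_apply]
    refine Finset.sum_congr rfl fun i _ => ?_
    change inner ℝ (x i) (β (EuclideanSpace.single i 1) y) = x i * β (EuclideanSpace.single i 1) y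
    simp [mul_comm]
  have hTinj : Function.Injective T := by
    rw [injective_iff_map_eq_zero]
    intro y hy
    have hβ0 : ∀ x, β x y = 0 := fun x => by rw [← hTβ, hy, inner_zero_right]
    have hψ0 : ∀ X, ψ (B X (e.symm y)) = 1 := fun X => by
      have := hβ0 (e X)
      simp only [β, ContinuousAddEquiv.symm_apply_apply] at this
      rw [hψL, this]
      simp
    have : e.symm y = 0 := by
      refine hB _ fun X => ?_
      by_contra h0
      refine hψ1 (DFunLike.ext _ _ fun a => ?_)
      have := hψ0 ((a / B X (e.symm y)) • X)
      rw [map_smul, LinearMap.smul_apply, smul_eq_mul, div_mul_cancel₀ _ h0] at this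
      simpa using this
    simpa using congrArg e this
  -- The sign compensates for the minus sign in the exponent of the Euclidean transform.
  let T' : EuclideanSpace ℝ (Fin N) ≃L[ℝ] EuclideanSpace ℝ (Fin N) :=
    (((-T : EuclideanSpace ℝ (Fin N) →L[ℝ] _) :
      EuclideanSpace ℝ (Fin N) →ₗ[ℝ] _).linearEquivOfInjective
      (fun x y hxy => hTinj (neg_injective hxy)) rfl).toContinuousLinearEquiv
  have hT' : ∀ y, T' y = -T y := fun y => rfl
  have hHaar : (ν.map e).IsAddHaarMeasure := e.isAddHaarMeasure_map ν
  set c := (ν.map e).addHaarScalarFactor volume with hc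
  have hmap : ν.map e = c • volume := Measure.isAddLeftInvariant_eq_smul _ _
  let f' : SchwartzMap (EuclideanSpace ℝ (Fin N)) ℂ :=
    SchwartzMap.compCLMOfContinuousLinearEquiv ℂ T' (FourierTransform.fourier f)
  have hf' : ∀ y, f' y = ∫ x, (Real.fourierChar (inner ℝ x (T y)) : ℂ) * f x := by
    intro y
    change (FourierTransform.fourier f) (T' y) = _
    rw [SchwartzMap.fourier_coe, Real.fourier_eq]
    refine integral_congr_ae (Eventually.of_forall fun x => ?_)
    simp only
    rw [hT', inner_neg_right, neg_neg, Circle.smul_def, smul_eq_mul]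
  have key : (bilinFourier ψ B ν fun X => f (e X)) = fun Y => (c : ℂ) * f' (e Y) := by
    ext Y
    have h1 : bilinFourier ψ B ν (fun X => f (e X)) Y =
        ∫ x, f x * (Real.fourierChar (β x (e Y)) : ℂ) ∂(ν.map e) := by
      refine Eq.trans ?_ (e.toHomeomorph.measurableEmbedding.integral_map (μ := ν)
        fun x => f x * (Real.fourierChar (β x (e Y)) : ℂ)).symm
      refine integral_congr_ae (Eventually.of_forall fun X => ?_)
      change f (e X) * (ψ (B X Y) : ℂ) =
        f (e X) * (Real.fourierChar (L (g (B (e.symm (e X)) (e.symm (e Y))))) : ℂ)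
      rw [e.symm_apply_apply, e.symm_apply_apply, hψL]
    rw [h1, hmap, integral_smul_nnreal_measure, hf']
    have h2 : ∀ z : ℂ, c • z = (c : ℂ) * z := fun z => rfl
    rw [h2]
    congr 1
    refine integral_congr_ae (Eventually.of_forall fun x => ?_)
    simp only
    rw [hTβ, mul_comm]
  rw [key]
  exact (integrable_comp_continuousAddEquiv e f').const_mul _

end Archimedean

/-! ### Existence of summation kernels. -/

section Kernel

lemma exists_schwartz_bump (N : ℕ) : ∃ f : SchwartzMap (EuclideanSpace ℝ (Fin N)) ℂ,
    (∀ x, ‖f x‖ ≤ 1) ∧ (∀ x, ((‖f x‖ : ℝ) : ℂ) = f x) ∧ ∀ x, ‖x‖ ≤ 1 → f x = 1 := by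
  let b : ContDiffBump (0 : EuclideanSpace ℝ (Fin N)) := ⟨1, 2, one_pos, one_lt_two⟩
  have hc : HasCompactSupport fun x => (b x : ℂ) :=
    b.hasCompactSupport.comp_left (g := fun r : ℝ => (r : ℂ)) Complex.ofReal_zero
  have hd : ContDiff ℝ (⊤ : ℕ∞) fun x => (b x : ℂ) := Complex.ofRealCLM.contDiff.comp b.contDiff
  have hn : ∀ x, ‖(b x : ℂ)‖ = b x := fun x => by
    rw [Complex.norm_real, Real.norm_of_nonneg b.nonneg]
  refine ⟨hc.toSchwartzMap hd, fun x => ?_, fun x => ?_, fun x hx => ?_⟩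
  · change ‖(b x : ℂ)‖ ≤ 1
    rw [hn]
    exact b.le_one
  · change ((‖(b x : ℂ)‖ : ℝ) : ℂ) = b x
    rw [hn]
  · change (b x : ℂ) = 1
    rw [b.one_of_mem_closedBall (by simpa using hx), Complex.ofReal_one]

lemma mul_nondegenerate {k : Type*} [Field k] (y : k) (h : ∀ x, LinearMap.mul k k x y = 0) :
    y = 0 := by
  simpa using h 1

variable {k : Type*} [NontriviallyNormedField k] [LocallyCompactSpace k]
  [MeasurableSpace k] [BorelSpace k] {ψ : AddChar k Circle} {μ : Measure k} [μ.IsAddHaarMeasure]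

theorem exists_isSummationKernel_of_isUltrametricDist [IsUltrametricDist k] (hψ : Continuous ψ)
    (hψ1 : ψ ≠ 1) : ∃ K : k → ℂ, IsSummationKernel ψ μ K := by
  have hcl : IsClopen (Metric.closedBall (0 : k) 1) :=
    IsUltrametricDist.isClopen_closedBall _ one_ne_zero
  have hl : IsLocallyConstant ((Metric.closedBall (0 : k) 1).indicator fun _ => (1 : ℂ)) :=
    (LocallyConstant.charFn ℂ hcl).isLocallyConstant
  have hs : HasCompactSupport ((Metric.closedBall (0 : k) 1).indicator fun _ => (1 : ℂ)) :=
    HasCompactSupport.of_support_subset_isCompact (isCompact_closedBall _ _)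
      Set.support_indicator_subset
  refine ⟨(Metric.closedBall (0 : k) 1).indicator fun _ => 1, hl.continuous, fun x => ?_,
    fun x => ?_, by simp, hl.continuous.integrable_of_hasCompactSupport hs,
    integrable_bilinFourier_of_isLocallyConstant hψ hψ1 _ mul_nondegenerate hl hs⟩ <;>
  by_cases hx : x ∈ Metric.closedBall (0 : k) 1 <;> simp [hx]

theorem exists_isSummationKernel_of_euclidean {d : ℕ} (g : k ≃ₜ+ EuclideanSpace ℝ (Fin d))
    (hψ : Continuous ψ) (hψ1 : ψ ≠ 1) : ∃ K : k → ℂ, IsSummationKernel ψ μ K := by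
  obtain ⟨f, hf1, hf0, hf⟩ := exists_schwartz_bump d
  exact ⟨fun x => f (g x), f.continuous.comp g.continuous, fun x => hf1 _, fun x => hf0 _,
    by simp [hf], integrable_comp_continuousAddEquiv g f,
    integrable_bilinFourier_of_schwartz hψ hψ1 _ mul_nondegenerate g g f⟩

end Kernel

/-! ### The bound along q for Schwartz functions, by dilating a bump. -/

section Domination

variable {k : Type*} [NontriviallyNormedField k] [LocallyCompactSpace k]
  [MeasurableSpace k] [BorelSpace k] {μ : Measure k} [μ.IsAddHaarMeasure]

lemma eLpNorm_comp_mul_left {a : k} (ha : a ≠ 0) (H : k → ℂ) :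
    eLpNorm (fun x => H (a * x)) 2 μ =
      ENNReal.ofReal (modulus a)⁻¹ ^ (1 / 2 : ℝ) * eLpNorm H 2 μ := by
  rw [eLpNorm_two_eq, eLpNorm_two_eq, lintegral_comp_mul_left μ ha (fun x => ‖H x‖ₑ ^ 2),
    ENNReal.mul_rpow_of_nonneg _ _ (by norm_num)]

variable {V : Type*} [AddCommGroup V] [Module k V] [FiniteDimensional k V]
  [TopologicalSpace V] [IsTopologicalAddGroup V] [ContinuousSMul k V] [T2Space V]
  [MeasurableSpace V] [BorelSpace V] {ν : Measure V} [ν.IsAddHaarMeasure]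
  {q : QuadraticForm k V}

/-- Substituting aX for X costs |a|^n and replaces H by H(a²·), whose L² norm is |a|⁻¹‖H‖₂. -/
lemma lintegral_dilate_le {Φ : V → ℂ} {C : ℝ≥0∞}
    (h : ∀ H : k → ℂ, Measurable H → MemLp H 2 μ →
      ∫⁻ X, ‖Φ X‖ₑ * ‖H (q X)‖ₑ ∂ν ≤ C * eLpNorm H 2 μ)
    {a : k} (ha : a ≠ 0) {H : k → ℂ} (hHm : Measurable H) (hH : MemLp H 2 μ) :
    ∫⁻ X, ‖Φ (a⁻¹ • X)‖ₑ * ‖H (q X)‖ₑ ∂ν ≤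
      ENNReal.ofReal (modulus a ^ Module.finrank k V * (modulus a)⁻¹) * C * eLpNorm H 2 μ := by
  have hp := modulus_pos ha
  have hscale := lintegral_comp_smul ν ha fun X => ‖Φ (a⁻¹ • X)‖ₑ * ‖H (q X)‖ₑ
  simp only [inv_smul_smul₀ ha, QuadraticMap.map_smul, smul_eq_mul] at hscale
  have hsq : ENNReal.ofReal (modulus (a * a))⁻¹ ^ (1 / 2 : ℝ) = ENNReal.ofReal (modulus a)⁻¹ := by
    rw [ENNReal.ofReal_rpow_of_nonneg (inv_nonneg.2 (modulus_nonneg _)) (by norm_num),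
      modulus_mul, mul_inv, ← sq, ← Real.sqrt_eq_rpow, Real.sqrt_sq (inv_nonneg.2 hp.le)]
  have hH' : MemLp (fun x => H (a * a * x)) 2 μ := by
    refine ⟨(hHm.comp (measurable_const_mul _)).aestronglyMeasurable, ?_⟩
    rw [eLpNorm_comp_mul_left (mul_ne_zero ha ha), hsq]
    exact ENNReal.mul_lt_top ENNReal.ofReal_lt_top hH.2
  have hb := h _ (hHm.comp (measurable_const_mul (a * a))) hH'
  simp only [Function.comp_apply] at hb
  rw [hscale] at hb
  calc ∫⁻ X, ‖Φ (a⁻¹ • X)‖ₑ * ‖H (q X)‖ₑ ∂ν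
      = ENNReal.ofReal (modulus a ^ Module.finrank k V) *
        (ENNReal.ofReal (modulus a ^ Module.finrank k V)⁻¹ *
          ∫⁻ X, ‖Φ (a⁻¹ • X)‖ₑ * ‖H (q X)‖ₑ ∂ν) := by
        rw [← mul_assoc, ← ENNReal.ofReal_mul (by positivity), mul_inv_cancel₀ (by positivity),
          ENNReal.ofReal_one, one_mul]
    _ ≤ ENNReal.ofReal (modulus a ^ Module.finrank k V) *
        (C * eLpNorm (fun x => H (a * a * x)) 2 μ) := mul_le_mul' le_rfl hb
    _ = _ := by
        rw [eLpNorm_comp_mul_left (mul_ne_zero ha ha), hsq, ENNReal.ofReal_mul (by positivity)]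
        ring

lemma schwartz_dyadic_bound {N : ℕ} (s : SchwartzMap (EuclideanSpace ℝ (Fin N)) ℂ) (M : ℕ) :
    ∃ A : ℝ, 0 ≤ A ∧ ∀ x, ∃ j : ℕ, ‖x‖ ≤ 2 ^ j ∧ ‖s x‖ ≤ A * ((2 : ℝ) ^ j)⁻¹ ^ M := by
  obtain ⟨D₀, hD₀, h₀⟩ := s.decay 0 0
  obtain ⟨D, hD, h⟩ := s.decay M 0
  refine ⟨D₀ + 2 ^ M * D, by positivity, fun x => ?_⟩
  have hex : ∃ j : ℕ, ‖x‖ ≤ 2 ^ j :=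
    (pow_unbounded_of_one_lt ‖x‖ (one_lt_two (α := ℝ))).imp fun _ h => h.le
  classical
  -- By minimality of j, either j = 0 and the sup bound D₀ applies, or ‖x‖ > 2^{j-1} and decay of
  -- order M applies; the shift by one costs the factor 2^M.
  refine ⟨Nat.find hex, Nat.find_spec hex, ?_⟩
  have h0 := h₀ x
  have h1 := h x
  simp only [pow_zero, one_mul, norm_iteratedFDeriv_zero] at h0 h1
  rcases Nat.eq_zero_or_pos (Nat.find hex) with hz | hpos
  · rw [hz]
    simp only [pow_zero, inv_one, one_pow, mul_one]
    have : 0 ≤ 2 ^ M * D := by positivity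
    linarith
  · obtain ⟨i, hi⟩ := Nat.exists_eq_succ_of_ne_zero hpos.ne'
    have hlt : (2 : ℝ) ^ i < ‖x‖ := not_le.1 (Nat.find_min hex (by omega))
    have h2 : (2 : ℝ) ^ (Nat.find hex) = 2 * 2 ^ i := by rw [hi, pow_succ, mul_comm]
    rw [h2]
    have hpow : ((2 : ℝ) ^ i) ^ M ≤ ‖x‖ ^ M := pow_le_pow_left₀ (by positivity) hlt.le M
    have h3 : ((2 : ℝ) ^ i) ^ M * ‖s x‖ ≤ D :=
      (mul_le_mul_of_nonneg_right hpow (norm_nonneg _)).trans h1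
    have hp : (0 : ℝ) < (2 ^ i) ^ M := by positivity
    rw [inv_pow, mul_pow, ← div_eq_mul_inv, le_div_iff₀ (by positivity)]
    nlinarith [pow_pos (two_pos : (0 : ℝ) < 2) M, mul_pos (pow_pos (two_pos : (0 : ℝ) < 2) M) hp]

/-- A Schwartz function is quadratically bounded if some function that is equal to one near the
origin is. -/
theorem isQuadraticallyBounded_of_schwartz [CharZero k] {N : ℕ}
    (e : V ≃ₜ+ EuclideanSpace ℝ (Fin N)) {Φ : V → ℂ} (hΦc : Continuous Φ)
    (hΦ1 : ∀ X, ‖e X‖ ≤ 1 → Φ X = 1) (hΦ : IsQuadraticallyBounded μ ν q Φ)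
    (s : SchwartzMap (EuclideanSpace ℝ (Fin N)) ℂ) :
    IsQuadraticallyBounded μ ν q fun X => s (e X) := by
  have hqc := continuous_quadraticForm q
  obtain ⟨C, hC, h⟩ := hΦ
  set ρ : ℝ := modulus (2 : k) ^ Module.finrank k V * (modulus (2 : k))⁻¹ with hρ
  have hρ0 : 0 ≤ ρ := mul_nonneg (pow_nonneg (modulus_nonneg _) _) (inv_nonneg.2 (modulus_nonneg _))
  -- Each doubling multiplies the constant by ρ; decay of order M beats it and leaves a geometric
  -- series of ratio at most 1/2.
  obtain ⟨M, hM⟩ : ∃ M : ℕ, 2 * ρ < 2 ^ M := pow_unbounded_of_one_lt _ one_lt_two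
  obtain ⟨A, hA, hs⟩ := schwartz_dyadic_bound s M
  have h2 : (2 : k) ≠ 0 := two_ne_zero
  have hdil : ∀ (j : ℕ) (X : V), e (((2 : k) ^ j)⁻¹ • X) = ((2 : ℝ) ^ j)⁻¹ • e X := by
    intro j X
    have h1 : (2 ^ j : ℕ) • e (((2 : k) ^ j)⁻¹ • X) = e X := by
      rw [← map_nsmul, ← Nat.cast_smul_eq_nsmul k, smul_smul, Nat.cast_pow, Nat.cast_ofNat,
        mul_inv_cancel₀ (pow_ne_zero j h2), one_smul]
    rw [← h1, ← Nat.cast_smul_eq_nsmul ℝ, smul_smul, Nat.cast_pow, Nat.cast_ofNat,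
      inv_mul_cancel₀ (by positivity), one_smul]
  have hpt : ∀ X, ‖s (e X)‖ₑ ≤
      ∑' j : ℕ, ENNReal.ofReal (A * ((2 : ℝ) ^ j)⁻¹ ^ M) * ‖Φ (((2 : k) ^ j)⁻¹ • X)‖ₑ := by
    intro X
    obtain ⟨j, hj, hsj⟩ := hs (e X)
    refine le_trans ?_ (ENNReal.le_tsum j)
    have : Φ (((2 : k) ^ j)⁻¹ • X) = 1 := by
      refine hΦ1 _ ?_
      rw [hdil, norm_smul, norm_inv, norm_pow, Real.norm_ofNat, inv_mul_le_one₀ (by positivity)]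
      exact hj
    rw [this, enorm_one, mul_one, ← ofReal_norm]
    exact ENNReal.ofReal_le_ofReal hsj
  refine ⟨∑' j : ℕ, ENNReal.ofReal (A * (1 / 2) ^ j) * C, ?_, fun H hHm hH => ?_⟩
  · rw [ENNReal.tsum_mul_right, ← ENNReal.ofReal_tsum_of_nonneg (fun j => by positivity)
      (summable_geometric_two.mul_left A)]
    exact ENNReal.mul_ne_top ENNReal.ofReal_ne_top hC
  calc ∫⁻ X, ‖s (e X)‖ₑ * ‖H (q X)‖ₑ ∂ν
      ≤ ∫⁻ X, ∑' j : ℕ, ENNReal.ofReal (A * ((2 : ℝ) ^ j)⁻¹ ^ M) *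
          (‖Φ (((2 : k) ^ j)⁻¹ • X)‖ₑ * ‖H (q X)‖ₑ) ∂ν := by
        refine lintegral_mono fun X => ?_
        simp_rw [← mul_assoc]
        rw [ENNReal.tsum_mul_right]
        gcongr
        exact hpt X
    _ = ∑' j : ℕ, ENNReal.ofReal (A * ((2 : ℝ) ^ j)⁻¹ ^ M) *
          ∫⁻ X, ‖Φ (((2 : k) ^ j)⁻¹ • X)‖ₑ * ‖H (q X)‖ₑ ∂ν := by
        have hm : ∀ j : ℕ, Measurable fun X => ‖Φ (((2 : k) ^ j)⁻¹ • X)‖ₑ * ‖H (q X)‖ₑ := fun j =>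
          (hΦc.comp (continuous_const_smul _)).enorm.measurable.mul
            (hHm.comp hqc.measurable).enorm
        rw [lintegral_tsum fun j => ((hm j).const_mul _).aemeasurable]
        exact tsum_congr fun j => lintegral_const_mul _ (hm j)
    _ ≤ ∑' j : ℕ, ENNReal.ofReal (A * (1 / 2) ^ j) * C * eLpNorm H 2 μ := by
        refine ENNReal.tsum_le_tsum fun j => ?_
        refine (mul_le_mul_right (lintegral_dilate_le h (pow_ne_zero j h2) hHm hH) _).trans ?_
        rw [← mul_assoc, ← mul_assoc, ← ENNReal.ofReal_mul (by positivity)]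
        refine mul_le_mul' (mul_le_mul' (ENNReal.ofReal_le_ofReal ?_) le_rfl) le_rfl
        have h1 : modulus ((2 : k) ^ j) ^ Module.finrank k V * (modulus ((2 : k) ^ j))⁻¹ =
            ρ ^ j := by
          rw [hρ, modulus_pow, mul_pow, inv_pow, pow_right_comm]
        rw [h1, mul_assoc]
        refine mul_le_mul_of_nonneg_left ?_ hA
        rw [inv_pow, pow_right_comm, ← inv_pow, ← mul_pow]
        refine pow_le_pow_left₀ (by positivity) ?_ j
        rw [inv_mul_le_iff₀ (by positivity)]
        linarith
    _ = _ := by rw [ENNReal.tsum_mul_right]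

end Domination

/-! ### Analytic properties of Bruhat–Schwartz functions. -/

section BruhatSchwartz

variable {k : Type*} [NontriviallyNormedField k] [LocallyCompactSpace k]
  [MeasurableSpace k] [BorelSpace k] [CharZero k] {μ : Measure k}
  {V : Type*} [AddCommGroup V] [Module k V] [FiniteDimensional k V]
  [TopologicalSpace V] [IsTopologicalAddGroup V] [ContinuousSMul k V] [T2Space V]
  [MeasurableSpace V] [BorelSpace V] {ψ : AddChar k Circle} {ν : Measure V}
  {q : QuadraticForm k V}

/-- The analytic properties of Bruhat–Schwartz functions. -/
theorem IsBruhatSchwartz.regularity {φ : V → ℂ} (hφ : IsBruhatSchwartz k φ)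
    (hψ : Continuous ψ) (hψ1 : ψ ≠ 1) (hq : q.Nondegenerate) (hV : 2 ≤ Module.finrank k V)
    (hμ : IsSelfDual ψ (LinearMap.mul k k) μ)
    (hν : IsSelfDual ψ (QuadraticMap.polarBilin q) ν) :
    (∃ K, IsSummationKernel ψ μ K) ∧ Continuous φ ∧ Integrable φ ν ∧
      Integrable (bilinFourier ψ (QuadraticMap.polarBilin q) ν φ) ν ∧
      IsQuadraticallyBounded μ ν q φ := by
  have := hμ.1
  have := hν.1
  have : Invertible (2 : k) := invertibleOfNonzero two_ne_zero
  have hB : ∀ Y, (∀ X, QuadraticMap.polarBilin q X Y = 0) → Y = 0 :=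
    (QuadraticMap.nondegenerate_polar_iff.2 hq).2
  rcases hφ with ⟨hk, hl, hc⟩ | ⟨-, N, e, s, hs⟩
  · obtain ⟨K, hK⟩ := exists_isSummationKernel_of_isUltrametricDist (μ := μ) hψ hψ1
    have hl' : IsLocallyConstant fun X => ((‖φ X‖ : ℝ) : ℂ) := hl.comp fun z => ((‖z‖ : ℝ) : ℂ)
    have hc' : HasCompactSupport fun X => ((‖φ X‖ : ℝ) : ℂ) :=
      hc.comp_left (g := fun z : ℂ => ((‖z‖ : ℝ) : ℂ)) (by simp)
    refine ⟨⟨K, hK⟩, hl.continuous, hl.continuous.integrable_of_hasCompactSupport hc,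
      integrable_bilinFourier_of_isLocallyConstant hψ hψ1 _ hB hl hc, ?_⟩
    obtain ⟨C, hC, h⟩ := isQuadraticallyBounded_of_nonneg hψ hμ hK hV hν hl'.continuous
      (hl'.continuous.integrable_of_hasCompactSupport hc')
      (integrable_bilinFourier_of_isLocallyConstant hψ hψ1 _ hB hl' hc') (fun X => by simp)
    refine ⟨C, hC, fun H hHm hH => le_trans (le_of_eq ?_) (h H hHm hH)⟩
    refine lintegral_congr fun X => ?_
    rw [← ofReal_norm (((‖φ X‖ : ℝ) : ℂ)), Complex.norm_real, norm_norm, ofReal_norm]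
  · have hφ : φ = fun X => s (e X) := funext hs
    subst hφ
    have : Nontrivial V := Module.nontrivial_of_finrank_pos (R := k) (by omega)
    obtain ⟨d, ⟨g⟩⟩ := exists_continuousAddEquiv_euclidean (k := k) e
    obtain ⟨K, hK⟩ := exists_isSummationKernel_of_euclidean (μ := μ) g hψ hψ1
    obtain ⟨f, hf1, hf0, hf⟩ := exists_schwartz_bump N
    have hfc : Continuous fun X => f (e X) := f.continuous.comp e.continuous
    refine ⟨⟨K, hK⟩, s.continuous.comp e.continuous, integrable_comp_continuousAddEquiv e s,
      integrable_bilinFourier_of_schwartz hψ hψ1 _ hB g e s, ?_⟩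
    refine isQuadraticallyBounded_of_schwartz e hfc (fun X hX => hf _ hX) ?_ s
    exact isQuadraticallyBounded_of_nonneg hψ hμ hK hV hν hfc
      (integrable_comp_continuousAddEquiv e f)
      (integrable_bilinFourier_of_schwartz hψ hψ1 _ hB g e f) fun X => hf0 _

end BruhatSchwartz

/-! ### Pushing W forward under squaring. -/

section Squaring

variable {k : Type*} [NontriviallyNormedField k] [LocallyCompactSpace k]
  [MeasurableSpace k] [BorelSpace k]

/-- Squaring has a Borel measurable section. -/
lemma exists_measurable_sqrt (k : Type*) [NontriviallyNormedField k] [LocallyCompactSpace k]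
    [MeasurableSpace k] [BorelSpace k] :
    ∃ s : k → k, Measurable s ∧ ∀ r, s (r ^ 2) = r ∨ s (r ^ 2) = -r := by
  have : ProperSpace k := ProperSpace.of_locallyCompactSpace k
  have he := measurableEmbedding_embeddingReal k
  -- A measurable embedding into ℝ selects one element of each pair ±x. Squaring is injective on
  -- this Borel set, hence a measurable embedding there.
  let P : Set k := {x | embeddingReal k (-x) ≤ embeddingReal k x}
  have hP : MeasurableSet P := measurableSet_le (he.measurable.comp measurable_neg) he.measurable
  have hinj : Set.InjOn (fun x : k => x ^ 2) P := by
    intro x hx y hy hxy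
    rcases sq_eq_sq_iff_eq_or_eq_neg.1 hxy with h | h
    · exact h
    · refine he.injective (le_antisymm ?_ ?_)
      · simpa [P, h] using hy
      · simpa [P, h] using hx
  have hemb : MeasurableEmbedding (P.domRestrict fun x : k => x ^ 2) :=
    (continuous_pow 2).continuousOn.measurableEmbedding hP hinj
  obtain ⟨s, hs, hsP⟩ := hemb.exists_measurable_extend (g := fun x : P => (x : k))
    measurable_subtype_coe fun _ => ⟨0⟩
  have hsP' : ∀ r ∈ P, s (r ^ 2) = r := fun r hr => congrFun hsP ⟨r, hr⟩
  refine ⟨s, hs, fun r => ?_⟩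
  rcases le_total (embeddingReal k (-r)) (embeddingReal k r) with h | h
  · exact Or.inl (hsP' r h)
  · refine Or.inr ?_
    rw [← neg_sq]
    exact hsP' (-r) (by simpa [P] using h)

lemma root_sq {k : Type*} [Field k] (r : k) : root (r ^ 2) = r ∨ root (r ^ 2) = -r := by
  have h : ∃ x : k, x ^ 2 = r ^ 2 := ⟨r, rfl⟩
  rw [root, dif_pos h]
  exact sq_eq_sq_iff_eq_or_eq_neg.1 h.choose_spec

lemma comp_root_sq {k : Type*} [Field k] {W : k → ℂ} (hW : ∀ x, W (-x) = W x) (r : k) :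
    W (root (r ^ 2)) = W r := by
  rcases root_sq r with h | h <;> simp [h, hW]

/-- The density of the image of Haar measure under squaring, on the nonzero squares. -/
noncomputable def squareDensity (u : k) : ℝ := 2 * (modulus (2 : k))⁻¹ * modulus u ^ (-(1 / 2) : ℝ)

lemma squareDensity_nonneg {k : Type*} [NontriviallyNormedField k] [LocallyCompactSpace k] (u : k) :
    0 ≤ squareDensity u :=
  mul_nonneg (mul_nonneg zero_le_two (inv_nonneg.2 (modulus_nonneg _)))
    (Real.rpow_nonneg (modulus_nonneg _) _)

lemma measurable_squareDensity : Measurable (squareDensity : k → ℝ) :=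
  (measurable_modulus.pow_const _).const_mul _

lemma squareDensity_sq {k : Type*} [NontriviallyNormedField k] [LocallyCompactSpace k] (r : k) :
    squareDensity (r ^ 2) = 2 * (modulus (2 : k))⁻¹ * (modulus r)⁻¹ := by
  rw [squareDensity, modulus_pow, ← Real.rpow_natCast, ← Real.rpow_mul (modulus_nonneg r),
    ← Real.rpow_neg_one (modulus r)]
  norm_num

variable [CharZero k] {μ : Measure k} [μ.IsAddHaarMeasure]

lemma map_sq_eq_withDensity : μ.map (fun x => x ^ 2) =
    (μ.restrict (nonzeroSquares k)).withDensity fun u => ENNReal.ofReal (squareDensity u) :=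
  map_sq_haar μ

lemma integral_comp_sq {g : k → ℂ} (hg : AEStronglyMeasurable g (μ.map fun x => x ^ 2)) :
    ∫ r, g (r ^ 2) ∂μ =
      ∫ u, (nonzeroSquares k).indicator (fun u => (squareDensity u : ℂ) * g u) u ∂μ := by
  rw [integral_indicator isOpen_nonzeroSquares.measurableSet,
    ← integral_map (continuous_pow 2).measurable.aemeasurable hg, map_sq_eq_withDensity,
    integral_withDensity_eq_integral_toReal_smul measurable_squareDensity.ennreal_ofReal
      (ae_of_all _ fun _ => ENNReal.ofReal_lt_top)]
  refine integral_congr_ae (ae_of_all _ fun u => ?_)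
  beta_reduce
  rw [ENNReal.toReal_ofReal (squareDensity_nonneg u), Complex.real_smul]

lemma integrable_comp_sq {g : k → ℂ} (hg : AEStronglyMeasurable g (μ.map fun x => x ^ 2))
    (hi : Integrable (fun r => g (r ^ 2)) μ) :
    Integrable ((nonzeroSquares k).indicator fun u => (squareDensity u : ℂ) * g u) μ := by
  have h := (integrable_map_measure hg (continuous_pow 2).measurable.aemeasurable).2 hi
  rw [map_sq_eq_withDensity, integrable_withDensity_iff_integrable_smul'
    measurable_squareDensity.ennreal_ofReal (ae_of_all _ fun _ => ENNReal.ofReal_lt_top)] at h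
  refine (integrable_indicator_iff isOpen_nonzeroSquares.measurableSet).2 (h.congr ?_)
  refine ae_of_all _ fun u => ?_
  beta_reduce
  rw [ENNReal.toReal_ofReal (squareDensity_nonneg u), Complex.real_smul]

lemma ae_map_sq_mem_nonzeroSquares : ∀ᵐ u ∂μ.map (fun x => x ^ 2), u ∈ nonzeroSquares k := by
  rw [map_sq_eq_withDensity]
  exact (withDensity_absolutelyContinuous _ _).ae_le
    (ae_restrict_mem isOpen_nonzeroSquares.measurableSet)

/-- `root` comes from choice, so its measurability is not available; W being even, it may be
replaced by a measurable section of squaring. -/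
lemma aestronglyMeasurable_comp_root {W : k → ℂ} (hW : AEStronglyMeasurable W μ)
    (hWe : ∀ x, W (-x) = W x) :
    AEStronglyMeasurable (fun u => W (root u)) (μ.map fun x => x ^ 2) := by
  obtain ⟨s, hs, hsr⟩ := exists_measurable_sqrt k
  have hsW : ∀ r, W (s (r ^ 2)) = W r := fun r => by rcases hsr r with h | h <;> simp [h, hWe]
  have hqm : Measure.QuasiMeasurePreserving s (μ.map fun x => x ^ 2) μ := by
    refine ⟨hs, Measure.AbsolutelyContinuous.mk fun N hN h0 => ?_⟩
    rw [Measure.map_apply hs hN, Measure.map_apply (continuous_pow 2).measurable (hs hN)]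
    refine measure_mono_null (t := N ∪ -N) (fun r hr => ?_)
      (measure_union_null h0 ((Measure.measure_neg μ N).trans h0))
    rcases hsr r with h | h
    · left
      simpa [h] using hr
    · right
      simpa [h] using hr
  refine (hW.comp_quasiMeasurePreserving hqm).congr ?_
  filter_upwards [ae_map_sq_mem_nonzeroSquares] with u hu
  obtain ⟨r, -, rfl⟩ := hu
  rw [Function.comp_apply, hsW, comp_root_sq hWe]

/-- The function `u ↦ 2|2|⁻¹|u|^{-1/2} W(√u)` on the nonzero squares, extended by zero. -/
noncomputable def pushSquare (W : k → ℂ) : k → ℂ :=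
  (nonzeroSquares k).indicator fun u => (squareDensity u : ℂ) * W (root u)

variable {W : k → ℂ}

lemma integrable_pushSquare (hW : Integrable W μ) (hWe : ∀ x, W (-x) = W x) :
    Integrable (pushSquare W) μ :=
  integrable_comp_sq (aestronglyMeasurable_comp_root hW.1 hWe) (by simpa only [comp_root_sq hWe])

/-- One of the two density factors in the square is absorbed by the change of variables; the other
becomes 2|2|⁻¹|r|⁻¹, which is why W²/|x| must be integrable. -/
lemma memLp_pushSquare (hW : Integrable W μ) (hWe : ∀ x, W (-x) = W x)
    (hW2 : Integrable (fun x => W x ^ 2 * (((modulus x)⁻¹ : ℝ) : ℂ)) μ) :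
    MemLp (pushSquare W) 2 μ := by
  have hm := aestronglyMeasurable_comp_root hW.1 hWe
  have hd : AEStronglyMeasurable (fun u : k => (squareDensity u : ℂ)) (μ.map fun x => x ^ 2) :=
    (Complex.measurable_ofReal.comp measurable_squareDensity).aestronglyMeasurable
  have h := integrable_comp_sq (hd.mul (hm.pow 2)) (by
    refine (hW2.const_mul ((2 * (modulus (2 : k))⁻¹ : ℝ) : ℂ)).congr (ae_of_all _ fun r => ?_)
    simp only [Pi.mul_apply, Pi.pow_apply, comp_root_sq hWe, squareDensity_sq]
    push_cast
    ring)
  refine (memLp_two_iff_integrable_sq_norm (integrable_pushSquare hW hWe).1).2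
    (h.norm.congr (ae_of_all _ fun u => ?_))
  by_cases hu : u ∈ nonzeroSquares k
  · simp only [pushSquare, Set.indicator_of_mem hu, Pi.mul_apply, Pi.pow_apply, ← norm_pow]
    ring_nf
  · simp [pushSquare, hu]

lemma fourierField_pushSquare {ψ : AddChar k Circle} (hψ : Continuous ψ)
    (hW : AEStronglyMeasurable W μ) (hWe : ∀ x, W (-x) = W x) (t : k) :
    fourierField ψ μ (pushSquare W) t = fourierTwo ψ μ W t := by
  have hc : AEStronglyMeasurable (fun u : k => (ψ (u * t) : ℂ)) (μ.map fun x => x ^ 2) :=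
    ((continuous_char hψ).comp (continuous_mul_const t)).measurable.aestronglyMeasurable
  have h := integral_comp_sq ((aestronglyMeasurable_comp_root hW hWe).mul hc)
  simp only [Pi.mul_apply, comp_root_sq hWe] at h
  rw [fourierField_apply, fourierTwo, h]
  refine integral_congr_ae (ae_of_all _ fun u => ?_)
  by_cases hu : u ∈ nonzeroSquares k <;> simp [pushSquare, hu, mul_assoc]

end Squaring

/-! ### Inserting δ by dilation. -/

section Dilation

variable {k : Type*} [NontriviallyNormedField k] [LocallyCompactSpace k]
  [MeasurableSpace k] [BorelSpace k] {μ : Measure k} [μ.IsAddHaarMeasure]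

lemma fourierField_comp_mul_left (ψ : AddChar k Circle) {δ : k} (hδ : δ ≠ 0) (G : k → ℂ) (t : k) :
    fourierField ψ μ (fun u => (((modulus δ)⁻¹ : ℝ) : ℂ) * G (δ⁻¹ * u)) t =
      fourierField ψ μ G (δ * t) := by
  have h := integral_comp_mul_left μ (inv_ne_zero hδ) fun u => G u * (ψ (u * (δ * t)) : ℂ)
  have hp : ((modulus δ : ℝ) : ℂ) ≠ 0 := Complex.ofReal_ne_zero.2 (modulus_pos hδ).ne'
  rw [modulus_inv, inv_inv] at h
  simp only [fourierField_apply, mul_assoc, integral_const_mul]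
  have hu : ∀ u : k, δ⁻¹ * (u * (δ * t)) = u * t := fun u => by field_simp
  simp only [mul_assoc, hu] at h
  rw [h, Complex.ofReal_inv, inv_mul_cancel_left₀ hp]

lemma memLp_comp_mul_left {δ : k} (hδ : δ ≠ 0) {G : k → ℂ} (hi : Integrable G μ)
    (hG : MemLp G 2 μ) : MemLp (fun u => G (δ * u)) 2 μ := by
  refine ⟨(integrable_comp_mul_left μ hδ hi).1, ?_⟩
  rw [eLpNorm_comp_mul_left hδ]
  exact ENNReal.mul_lt_top (ENNReal.rpow_lt_top_of_nonneg (by norm_num) ENNReal.ofReal_ne_top) hG.2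

end Dilation

lemma mem_squareClassSet_iff {k V : Type*} [Field k] [AddCommGroup V] [Module k V]
    {q : QuadraticForm k V} {δ : k} (hδ : δ ≠ 0) {X : V} :
    X ∈ squareClassSet q δ ↔ δ⁻¹ * q X ∈ nonzeroSquares k := by
  simp only [squareClassSet, nonzeroSquares, Set.mem_ofPred_eq]
  refine exists_congr fun a => and_congr_right fun _ => ?_
  rw [eq_inv_mul_iff_mul_eq₀ hδ, eq_comm]

end QuadraticFourier

/-! ### The main theorem. -/

open QuadraticFourier

theorem mainTheorem11
    {k : Type*} [NontriviallyNormedField k] [LocallyCompactSpace k] [CharZero k]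
    [MeasurableSpace k] [BorelSpace k]
    {V : Type*} [AddCommGroup V] [Module k V] [FiniteDimensional k V]
    [TopologicalSpace V] [IsTopologicalAddGroup V] [ContinuousSMul k V] [T2Space V]
    [MeasurableSpace V] [BorelSpace V]
    (q : QuadraticForm k V) (hq : q.Nondegenerate) (hV : 2 ≤ Module.finrank k V)
    (ψ : AddChar k Circle) (hψc : Continuous ψ) (hψ : ψ ≠ 1)
    (μ : MeasureTheory.Measure k)
    (hμ : QuadraticFourier.IsSelfDual ψ (LinearMap.mul k k) μ)
    (ν : MeasureTheory.Measure V)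
    (hν : QuadraticFourier.IsSelfDual ψ (QuadraticMap.polarBilin q) ν)
    (W : k → ℂ) (hW : MeasureTheory.Integrable W μ) (hWeven : ∀ x, W (-x) = W x)
    (hW2 : MeasureTheory.Integrable
      (fun x => W x ^ 2 * (((QuadraticFourier.modulus x)⁻¹ : ℝ) : ℂ)) μ)
    (φ : V → ℂ) (hφ : QuadraticFourier.IsBruhatSchwartz k φ)
    (δ : k) (hδ : δ ≠ 0) :
    MeasureTheory.Integrable (fun t : k =>
      QuadraticFourier.fourierTwo ψ μ W (δ * t) * QuadraticFourier.fourierQuad ψ q ν φ (-t)) μ ∧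
    MeasureTheory.IntegrableOn (fun X : V =>
      W (QuadraticFourier.root (δ⁻¹ * q X)) * φ X *
        ((QuadraticFourier.modulus (δ⁻¹ * q X) ^ (-(1 / 2) : ℝ) : ℝ) : ℂ))
      (QuadraticFourier.squareClassSet q δ) ν ∧
    ∫ t : k, QuadraticFourier.fourierTwo ψ μ W (δ * t) *
        QuadraticFourier.fourierQuad ψ q ν φ (-t) ∂μ =
      2 * (((QuadraticFourier.modulus (2 * δ))⁻¹ : ℝ) : ℂ) *
        ∫ X in QuadraticFourier.squareClassSet q δ,
          W (QuadraticFourier.root (δ⁻¹ * q X)) * φ X *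
            ((QuadraticFourier.modulus (δ⁻¹ * q X) ^ (-(1 / 2) : ℝ) : ℝ) : ℂ) ∂ν := by
  have := hμ.1
  have := hν.1
  obtain ⟨⟨K, hK⟩, hφc, hφi, hφi', hφb⟩ := hφ.regularity hψc hψ hq hV hμ hν
  -- The factor |δ|⁻¹ makes the transform of G at t equal F₂W(δt); with 2|2|⁻¹ from squaring it
  -- yields the constant 2|2δ|⁻¹.
  set G : k → ℂ := fun u => (((modulus δ)⁻¹ : ℝ) : ℂ) * pushSquare W (δ⁻¹ * u) with hG
  have hi₀ := integrable_pushSquare hW hWeven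
  have hGi : Integrable G μ :=
    (integrable_comp_mul_left μ (inv_ne_zero hδ) hi₀).const_mul _
  have hG2 : MemLp G 2 μ :=
    (memLp_comp_mul_left (inv_ne_zero hδ) hi₀ (memLp_pushSquare hW hWeven hW2)).const_mul _
  have hGt : ∀ t, fourierField ψ μ G t = fourierTwo ψ μ W (δ * t) := fun t => by
    rw [hG, fourierField_comp_mul_left ψ hδ, fourierField_pushSquare hψc hW.1 hWeven]
  obtain ⟨h1, h2, h3⟩ :=
    integral_fourier_mul_fourierQuad hψc hμ hK hV hν hφc hφi hφi' hφb hGi hG2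
  simp only [hGt] at h1 h3
  have hS : MeasurableSet (squareClassSet q δ) := by
    have : squareClassSet q δ = (fun X => δ⁻¹ * q X) ⁻¹' nonzeroSquares k :=
      Set.ext fun X => mem_squareClassSet_iff hδ
    rw [this]
    exact (isOpen_nonzeroSquares.preimage
      (continuous_const.mul (continuous_quadraticForm q))).measurableSet
  set c : ℂ := 2 * (((modulus (2 * δ))⁻¹ : ℝ) : ℂ) with hc
  have hc0 : c ≠ 0 := mul_ne_zero two_ne_zero (Complex.ofReal_ne_zero.2
    (inv_ne_zero (modulus_pos (mul_ne_zero two_ne_zero hδ)).ne'))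
  have hφG : (fun X => φ X * G (q X)) = fun X => c * (squareClassSet q δ).indicator (fun X =>
      W (root (δ⁻¹ * q X)) * φ X * ((modulus (δ⁻¹ * q X) ^ (-(1 / 2) : ℝ) : ℝ) : ℂ)) X := by
    funext X
    by_cases hX : X ∈ squareClassSet q δ
    · have hX' := (mem_squareClassSet_iff hδ).1 hX
      rw [Set.indicator_of_mem hX, hG, hc]
      simp only [pushSquare, Set.indicator_of_mem hX', squareDensity, modulus_mul 2 δ, mul_inv]
      push_cast
      ring
    · have hX' := mt (mem_squareClassSet_iff hδ).2 hX
      simp [hX, hG, pushSquare, hX']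
  rw [hφG] at h2 h3
  rw [integral_const_mul, integral_indicator hS] at h3
  refine ⟨h1, ?_, h3⟩
  rw [← integrable_indicator_iff hS]
  exact (integrable_const_mul_iff (isUnit_iff_ne_zero.2 hc0) _).1 h2
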